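/- Let $\mu,a>0$, $g\ge 0$ and $A\in(0,1)$. Define $$F(x)=\frac{a}{\mu A}\Bigl(1-e^{x}-\frac{A}{4}e^{-x}\Bigr),\qquad G(x)=\frac{1}{4\mu}\Bigl(Ae^{-x}-\frac{g}{A}e^{2x}\Bigr),\qquad x\in\mathbb{R},$$ let $H_\pm=\frac12\bigl(1\pm\sqrt{1-A}\bigr)$ and $\rho_\pm=\log H_\pm$ (the two zeros of $F$), and let $\rho_\star$ be the unique number $\rho_\star>\rho_-$ with $\int_{\rho_-}^{\rho_\star}\bigl(1-e^{x}-\frac A4e^{-x}\bigr)\,dx=0$; it satisfies $\rho_\star>\rho_+$. Then the following hold. 1. If $G(\rho_\star)>0$, there exists a smooth $\rho:\mathbb{R}\to[\rho_-,\rho_\star]$ with $$\rho''=F(\rho)-G(\rho)\rho'\quad\text{on }\mathbb{R},\qquad \lim_{t\to-\infty}\rho(t)=\rho_-,\qquad \lim_{t\to\infty}\rho(t)=\rho_+,$$ and there exist constants $\alpha>0$ and $C_m>0$, $m\in\mathbb{N}=\{0,1,2,\dots\}$, such that $$\sup_{t\le0}e^{\alpha|t|}|\rho(t)-\rho_-|+\sup_{t\ge0}e^{\alpha|t|}|\rho(t)-\rho_+|\le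 C_0,\qquad \sup_{t\in\mathbb{R}}e^{\alpha|t|}|\rho^{(m)}(t)|\le C_m\ \text{ for all } m\ge1.$$ 2. If $G(\rho_-)<0$, there exists a smooth $\rho:\mathbb{R}\to[\rho_-,\rho_\star]$ with $$\rho''=F(\rho)-G(\rho)\rho'\quad\text{on }\mathbb{R},\qquad \lim_{t\to-\infty}\rho(t)=\rho_+,\qquad \lim_{t\to\infty}\rho(t)=\rho_-,$$ and there exist constants $\alpha>0$ and $C_m>0$, $m\in\mathbb{N}$, such that $$\sup_{t\le0}e^{\alpha|t|}|\rho(t)-\rho_+|+\sup_{t\ge0}e^{\alpha|t|}|\rho(t)-\rho_-|\le C_0,\qquad \sup_{t\in\mathbb{R}}e^{\alpha|t|}|\rho^{(m)}(t)|\le C_m\ \text{ for all } m\ge1.$$ -/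

import Mathlib

open Filter Topology
open scoped ContDiff

namespace ShallowWater

noncomputable section

/-- The larger equilibrium height: the larger root of `H - H ^ 2 = A / 4`. -/
def heightPlus (A : ℝ) : ℝ := (1 + √(1 - A)) / 2

/-- The smaller equilibrium height: the smaller root of `H - H ^ 2 = A / 4`. -/
def heightMinus (A : ℝ) : ℝ := (1 - √(1 - A)) / 2

/-- The equilibrium `ρ₊ = log H₊`. -/
def rhoPlus (A : ℝ) : ℝ := Real.log (heightPlus A)

/-- The equilibrium `ρ₋ = log H₋`. -/
def rhoMinus (A : ℝ) : ℝ := Real.log (heightMinus A)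

/-- The force `F` of the Liénard equation. -/
def force (μ a A x : ℝ) : ℝ :=
  a / (μ * A) * (1 - Real.exp x - A / 4 * Real.exp (-x))

/-- The damping coefficient `G` of the Liénard equation. -/
def damping (μ g A x : ℝ) : ℝ :=
  1 / (4 * μ) * (A * Real.exp (-x) - g / A * Real.exp (2 * x))

/-- The defining property of the equipotential state `ρ⋆`: it lies to the right of `ρ₋`, and
the force (whose positive prefactor `a / (μ A)` is irrelevant here) has zero integral
from `ρ₋` to it. -/
def IsEquipotential (A x : ℝ) : Prop :=
  rhoMinus A < x ∧
    ∫ s in (rhoMinus A)..x, (1 - Real.exp s - A / 4 * Real.exp (-s)) = 0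

/-- The equipotential state `ρ⋆`; for `0 < A < 1` it is the unique `x` with
`IsEquipotential A x`, by `existsUnique_isEquipotential`. -/
def rhoStar (A : ℝ) : ℝ := Classical.epsilon (IsEquipotential A)

end

theorem heights {A : ℝ} (h0 : 0 < A) (h1 : A < 1) :
    0 < heightMinus A ∧ heightMinus A < heightPlus A ∧
      heightMinus A + heightPlus A = 1 ∧ heightMinus A * heightPlus A = A / 4 := by
  have hs : 0 < √(1 - A) := Real.sqrt_pos.2 (by linarith)
  have hq : √(1 - A) ^ 2 = 1 - A := Real.sq_sqrt (by linarith)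
  unfold heightMinus heightPlus
  refine ⟨?_, ?_, ?_, ?_⟩ <;> nlinarith

theorem force_factor {A : ℝ} (h0 : 0 < A) (h1 : A < 1) (x : ℝ) :
    1 - Real.exp x - A / 4 * Real.exp (-x) =
      Real.exp (-x) * ((Real.exp x - heightMinus A) * (heightPlus A - Real.exp x)) := by
  obtain ⟨-, -, hs, hp⟩ := heights h0 h1
  have he : Real.exp (-x) * Real.exp x = 1 := by rw [← Real.exp_add]; simp
  linear_combination (-1 + Real.exp x) * he + Real.exp (-x) * hp
    - Real.exp (-x) * Real.exp x * hs

theorem hasDerivAt_primitive (A x : ℝ) :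
    HasDerivAt (fun s => s - Real.exp s + A / 4 * Real.exp (-s))
      (1 - Real.exp x - A / 4 * Real.exp (-x)) x := by
  have h := (((hasDerivAt_id' x).fun_sub (Real.hasDerivAt_exp x)).fun_add
    (((hasDerivAt_id' x).fun_neg.exp).const_mul (A / 4)))
  exact h.congr_deriv (by ring)

theorem integral_force (A p x : ℝ) :
    ∫ s in p..x, (1 - Real.exp s - A / 4 * Real.exp (-s)) =
      (x - Real.exp x + A / 4 * Real.exp (-x)) -
        (p - Real.exp p + A / 4 * Real.exp (-p)) :=
  intervalIntegral.integral_eq_sub_of_hasDerivAt (fun s _ => hasDerivAt_primitive A s)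
    (Continuous.intervalIntegrable (by fun_prop) _ _)

theorem existsUnique_isEquipotential {A : ℝ} (h0 : 0 < A) (h1 : A < 1) :
    (∃! x, IsEquipotential A x) ∧ ∀ x, IsEquipotential A x → rhoPlus A < x := by
  obtain ⟨hm, hlt, hs, hp⟩ := heights h0 h1
  have hpos : 0 < heightPlus A := hm.trans hlt
  have hpr : rhoMinus A < rhoPlus A := Real.log_lt_log hm hlt
  set Q : ℝ → ℝ := fun x => x - Real.exp x + A / 4 * Real.exp (-x) with hQ
  have hQc : Continuous Q := by fun_prop
  have hder : ∀ x, deriv Q x = 1 - Real.exp x - A / 4 * Real.exp (-x) := fun x =>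
    (hasDerivAt_primitive A x).deriv
  have hmono : StrictMonoOn Q (Set.Icc (rhoMinus A) (rhoPlus A)) := by
    refine strictMonoOn_of_deriv_pos (convex_Icc _ _) hQc.continuousOn fun x hx => ?_
    rw [interior_Icc] at hx
    rw [hder, force_factor h0 h1]
    have e1 : heightMinus A < Real.exp x := (Real.log_lt_iff_lt_exp hm).1 hx.1
    have e2 : Real.exp x < heightPlus A := (Real.lt_log_iff_exp_lt hpos).1 hx.2
    exact mul_pos (Real.exp_pos _) (mul_pos (by linarith) (by linarith))
  have hanti : StrictAntiOn Q (Set.Ici (rhoPlus A)) := by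
    refine strictAntiOn_of_deriv_neg (convex_Ici _) hQc.continuousOn fun x hx => ?_
    rw [interior_Ici] at hx
    rw [hder, force_factor h0 h1]
    have e2 : heightPlus A < Real.exp x := (Real.log_lt_iff_lt_exp hpos).1 hx
    exact mul_neg_of_pos_of_neg (Real.exp_pos _)
      (mul_neg_of_pos_of_neg (by linarith) (by linarith))
  have hiff : ∀ x, IsEquipotential A x ↔ rhoMinus A < x ∧ Q x = Q (rhoMinus A) := fun x => by
    unfold IsEquipotential
    rw [integral_force, sub_eq_zero]
  have hright : ∀ x, IsEquipotential A x → rhoPlus A < x := fun x hx => by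
    rw [hiff] at hx
    by_contra! hle
    exact absurd hx.2 (hmono (Set.left_mem_Icc.2 hpr.le) ⟨hx.1.le, hle⟩ hx.1).ne'
  refine ⟨?_, hright⟩
  have hbig : ∃ y, rhoPlus A ≤ y ∧ Q y ≤ Q (rhoMinus A) := by
    refine ⟨max (max (rhoPlus A) 0) (1 + 2 * |Q (rhoMinus A)|),
      (le_max_left _ _).trans (le_max_left _ _), ?_⟩
    set y := max (max (rhoPlus A) 0) (1 + 2 * |Q (rhoMinus A)|)
    have y0 : 0 ≤ y := (le_max_right _ _).trans (le_max_left _ _)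
    have y1 : 1 + 2 * |Q (rhoMinus A)| ≤ y := le_max_right _ _
    have hexp := Real.quadratic_le_exp_of_nonneg y0
    have hneg : Real.exp (-y) ≤ 1 := Real.exp_le_one_iff.2 (by linarith)
    have hab := neg_abs_le (Q (rhoMinus A))
    have hab0 := abs_nonneg (Q (rhoMinus A))
    have : Q y ≤ -1 - y ^ 2 / 2 + 1 / 4 := by
      simp only [hQ]
      nlinarith [Real.exp_pos (-y)]
    nlinarith
  obtain ⟨y, hy, hQy⟩ := hbig
  have hQr : Q (rhoMinus A) < Q (rhoPlus A) :=
    hmono (Set.left_mem_Icc.2 hpr.le) (Set.right_mem_Icc.2 hpr.le) hpr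
  obtain ⟨x, hx, hxQ⟩ := intermediate_value_Icc' hy hQc.continuousOn ⟨hQy, hQr.le⟩
  refine ⟨x, (hiff x).2 ⟨hpr.trans_le hx.1, hxQ⟩, fun z hz => ?_⟩
  exact hanti.injOn (hright z hz).le hx.1 (((hiff z).1 hz).2.trans hxQ.symm)

theorem isEquipotential_rhoStar {A : ℝ} (h0 : 0 < A) (h1 : A < 1) :
    IsEquipotential A (rhoStar A) :=
  Classical.epsilon_spec (existsUnique_isEquipotential h0 h1).1.exists

end ShallowWater

/-!
Both parts are instances of one statement about a damped Liénard equation `x'' = F x - G x * x'` in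
which `F` is concave with zeros `p < q`, the potential `Φ x = ∫_p^x F` returns to zero at `r > q`,
and `G > 0` on `[p, r]` (`IsDampedWell`): it has an orbit from the saddle `p` to the sink `q`, with
exponential convergence at both ends (`IsDampedWell.exists_heteroclinic`). The damping is decreasing
in `x`, so `G(ρ⋆) > 0` makes it positive on `[ρ₋, ρ⋆]`; if instead `G(ρ₋) < 0`, it is negative there
and reversing time changes its sign and exchanges the two limits.

Existence of the orbit needs no unstable manifold theorem. The energy `v ^ 2 / 2 - Φ x` decreases
along orbits, so the region of negative energy over `(p, r)` is forward invariant; the field is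
truncated outside it to have global trajectories. For `m ∈ (p, q)` and small `α > 0` the cone
`v ≥ α (x - p)` is forward invariant as long as `x ≤ m`, because `F` lies above its chord over
`[p, m]` (`IsDampedWell.cone_invariant`). Orbits started on the edge of the cone at distance `ε` from
the saddle therefore reach `x = m`, after a time that tends to infinity as `ε → 0` by Grönwall's
inequality. A compactness argument on the points at which they cross `x = m` gives an orbit on `ℝ`
that lies in the cone for all `t ≤ 0` (`IsDampedWell.exists_entire_orbit`).

The cone condition gives `x - p = O(exp (α t))` as `t → -∞`. For `t ≥ 0` the energy is bounded away
from zero, hence so is the distance to the saddle, and concavity of `F` makes the energy plus a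
small multiple of `(x - q) v` an exponentially decaying Lyapunov function
(`IsDampedWell.exists_decay_right`). Decay of all derivatives follows by induction from the equation
in the form `x'' = F x - (Γ x)'` with `Γ' = G` (`IsDampedWell.expDecay_iteratedDeriv`).
-/

namespace ShallowWater

open scoped NNReal

/-! ### Global trajectories of bounded Lipschitz vector fields -/

section Flow

variable {E : Type*} [NormedAddCommGroup E] [NormedSpace ℝ E]

theorem dist_le_of_hasDerivAt {X : E → E} {K : ℝ≥0} (hK : LipschitzWith K X) {z w : ℝ → E}
    (hz : ∀ t, HasDerivAt z (X (z t)) t) (hw : ∀ t, HasDerivAt w (X (w t)) t) (t : ℝ) :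
    dist (z t) (w t) ≤ dist (z 0) (w 0) * Real.exp (K * |t|) := by
  -- Grönwall's inequality runs forward in time; for `t < 0` it is applied to the reversed field.
  have key : ∀ {Y : E → E}, LipschitzWith K Y → ∀ {z w : ℝ → E},
      (∀ t, HasDerivAt z (Y (z t)) t) → (∀ t, HasDerivAt w (Y (w t)) t) → ∀ t, 0 ≤ t →
      dist (z t) (w t) ≤ dist (z 0) (w 0) * Real.exp (K * t) := by
    intro Y hY z w hz hw t ht
    have := dist_le_of_trajectories_ODE (v := fun _ => Y) (K := K) (f := z) (g := w) (a := 0)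
      (b := t) (fun _ => hY) (fun s _ => (hz s).continuousAt.continuousWithinAt)
      (fun s _ => (hz s).hasDerivWithinAt) (fun s _ => (hw s).continuousAt.continuousWithinAt)
      (fun s _ => (hw s).hasDerivWithinAt) le_rfl t ⟨ht, le_rfl⟩
    simpa using this
  rcases le_total 0 t with ht | ht
  · rw [abs_of_nonneg ht]
    exact key hK hz hw t ht
  · have hrev : ∀ {z : ℝ → E}, (∀ t, HasDerivAt z (X (z t)) t) →
        ∀ t, HasDerivAt (fun s => z (-s)) ((fun x => -X x) (z (-t))) t := by
      intro z hz t
      simpa [Function.comp_def] using (hz (-t)).scomp t (hasDerivAt_neg t)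
    have := key hK.neg (hrev hz) (hrev hw) (-t) (by linarith)
    rw [abs_of_nonpos ht]
    simpa using this

theorem exists_hasDerivAt_of_lipschitz_of_bounded [CompleteSpace E] {X : E → E} {K M : ℝ≥0}
    (hK : LipschitzWith K X) (hM : ∀ x, ‖X x‖ ≤ M) (x : E) :
    ∃ z : ℝ → E, z 0 = x ∧ ∀ t, HasDerivAt z (X (z t)) t := by
  have hloc : ∀ n : ℕ, ∃ z : ℝ → E, z 0 = x ∧
      ∀ t ∈ Set.Ioo (-(n + 1) : ℝ) (n + 1), HasDerivAt z (X (z t)) t := by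
    intro n
    have h0 : (0 : ℝ) ∈ Set.Icc (-(n + 1) : ℝ) (n + 1) := by
      constructor <;> linarith [n.cast_nonneg (α := ℝ)]
    have hPL : IsPicardLindelof (fun _ => X) (⟨0, h0⟩ : Set.Icc (-(n + 1) : ℝ) (n + 1)) x
        (M * (n + 1)) 0 M K :=
      { lipschitzOnWith := fun _ _ => hK.lipschitzOnWith
        continuousOn := fun _ _ => continuousOn_const
        norm_le := fun _ _ y _ => hM y
        mul_max_le := by simp }
    obtain ⟨z, hz0, hz⟩ := hPL.exists_eq_forall_mem_Icc_hasDerivWithinAt₀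
    exact ⟨z, hz0, fun t ht => (hz t (Set.Ioo_subset_Icc_self ht)).hasDerivAt
      (Icc_mem_nhds ht.1 ht.2)⟩
  choose z hz0 hz using hloc
  have huniq : ∀ n k : ℕ, n ≤ k → Set.EqOn (z n) (z k) (Set.Ioo (-(n + 1) : ℝ) (n + 1)) := by
    intro n k hnk
    have hnk' : (n : ℝ) ≤ k := by exact_mod_cast hnk
    refine ODE_solution_unique_of_mem_Ioo (v := fun _ => X) (s := fun _ => Set.univ) (K := K)
      (t₀ := 0) (fun _ _ => hK.lipschitzOnWith)
      (by constructor <;> linarith [n.cast_nonneg (α := ℝ)]) (fun t ht => ⟨hz n t ht, trivial⟩)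
      (fun t ht => ⟨hz k t ⟨by linarith [ht.1], by linarith [ht.2]⟩, trivial⟩)
      ((hz0 n).trans (hz0 k).symm)
  refine ⟨fun t => z ⌈|t|⌉₊ t, hz0 _, fun t => ?_⟩
  have ht : ∀ s : ℝ, |s| < ⌈|t|⌉₊ + 1 → z ⌈|s|⌉₊ s = z ⌈|t|⌉₊ s := by
    intro s hs
    have hs' : s ∈ Set.Ioo (-((⌈|s|⌉₊ : ℕ) + 1) : ℝ) ((⌈|s|⌉₊ : ℕ) + 1) :=
      abs_lt.1 (by linarith [Nat.le_ceil |s|])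
    rcases le_total ⌈|s|⌉₊ ⌈|t|⌉₊ with h | h
    · exact huniq _ _ h hs'
    · exact (huniq _ _ h (abs_lt.1 hs)).symm
  have htt : |t| < ⌈|t|⌉₊ + 1 := by linarith [Nat.le_ceil |t|]
  refine (hz ⌈|t|⌉₊ t (abs_lt.1 htt)).congr_of_eventuallyEq ?_
  filter_upwards [(continuous_abs.isOpen_preimage _ isOpen_Iio).mem_nhds htt] with s hs
  exact ht s hs

end Flow

/-! ### Differential inequalities -/

/-- A linear differential inequality `w' ≥ -k w` preserves nonnegativity: multiply by the
integrating factor `exp (∫ k)`. -/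
theorem nonneg_of_neg_mul_le_deriv {w w' k : ℝ → ℝ} (hk : Continuous k)
    (hw : ∀ t, HasDerivAt w (w' t) t) {s b : ℝ} (hs : 0 ≤ w s)
    (h : ∀ t ∈ Set.Icc s b, -k t * w t ≤ w' t) : ∀ t ∈ Set.Icc s b, 0 ≤ w t := by
  set J : ℝ → ℝ := fun t => ∫ τ in s..t, k τ with hJ
  have hJd : ∀ t, HasDerivAt J (k t) t := fun t => (hk.integral_hasStrictDerivAt s t).hasDerivAt
  have hd : ∀ t, HasDerivAt (fun t => w t * Real.exp (J t))
      (w' t * Real.exp (J t) + w t * (Real.exp (J t) * k t)) t := fun t =>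
    (hw t).mul (hJd t).exp
  have hmono : MonotoneOn (fun t => w t * Real.exp (J t)) (Set.Icc s b) := by
    refine monotoneOn_of_deriv_nonneg (convex_Icc s b)
      (fun t _ => (hd t).continuousAt.continuousWithinAt)
      (fun t _ => (hd t).differentiableAt.differentiableWithinAt) fun t ht => ?_
    rw [(hd t).deriv]
    have h1 := h t (interior_subset ht)
    nlinarith [Real.exp_pos (J t)]
  intro t ht
  have h1 := hmono (Set.left_mem_Icc.2 (ht.1.trans ht.2)) ht ht.1
  have h2 : 0 ≤ w t * Real.exp (J t) := by
    refine le_trans ?_ h1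
    positivity
  exact nonneg_of_mul_nonneg_left h2 (Real.exp_pos _)

/-- If `Φ' = f` and `f y * (y - x₀) ≤ K * (y - x₀) ^ 2` between `x₀` and `x`, then `Φ` lies below the
parabola of curvature `K` with vertex at `x₀`: compare the two along the segment. -/
theorem sub_le_sq_of_deriv_mul_le {Φ f : ℝ → ℝ} (hd : ∀ y, HasDerivAt Φ (f y) y) {x₀ x K : ℝ}
    (h : ∀ y ∈ Set.uIcc x₀ x, f y * (y - x₀) ≤ K * (y - x₀) ^ 2) :
    Φ x - Φ x₀ ≤ K * (x - x₀) ^ 2 / 2 := by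
  have hline : ∀ s, HasDerivAt (fun s : ℝ => x₀ + s * (x - x₀)) (x - x₀) s := fun s => by
    simpa using ((hasDerivAt_id' s).mul_const (x - x₀)).const_add x₀
  have hψ : ∀ s, HasDerivAt
      (fun s : ℝ => Φ (x₀ + s * (x - x₀)) - K * (x - x₀) ^ 2 / 2 * s ^ 2)
      (f (x₀ + s * (x - x₀)) * (x - x₀) - K * (x - x₀) ^ 2 * s) s := fun s =>
    (((hd _).comp s (hline s)).fun_sub (((hasDerivAt_id' s).fun_pow 2).const_mul
      (K * (x - x₀) ^ 2 / 2))).congr_deriv (by push_cast; ring)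
  have hanti : AntitoneOn
      (fun s : ℝ => Φ (x₀ + s * (x - x₀)) - K * (x - x₀) ^ 2 / 2 * s ^ 2) (Set.Icc 0 1) := by
    refine antitoneOn_of_deriv_nonpos (convex_Icc _ _)
      (fun s _ => (hψ s).continuousAt.continuousWithinAt)
      (fun s _ => (hψ s).differentiableAt.differentiableWithinAt) fun s hs => ?_
    rw [interior_Icc] at hs
    rw [(hψ s).deriv]
    have hmem : x₀ + s * (x - x₀) ∈ Set.uIcc x₀ x := by
      rw [Set.mem_uIcc]
      rcases le_total x₀ x with hx | hx
      · left; constructor <;> nlinarith [hs.1, hs.2]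
      · right; constructor <;> nlinarith [hs.1, hs.2]
    have h1 := h _ hmem
    rw [add_sub_cancel_left] at h1
    have h2 : s * (f (x₀ + s * (x - x₀)) * (x - x₀) - K * (x - x₀) ^ 2 * s) ≤ 0 := by linarith
    exact nonpos_of_mul_nonpos_right h2 hs.1
  have := hanti (Set.left_mem_Icc.2 zero_le_one) (Set.right_mem_Icc.2 zero_le_one) zero_le_one
  simp only [one_mul, zero_mul, add_zero, add_sub_cancel] at this
  linarith

/-- The lower bound dual to `sub_le_sq_of_deriv_mul_le`. -/
theorem sq_le_sub_of_le_deriv_mul {Φ f : ℝ → ℝ} (hd : ∀ y, HasDerivAt Φ (f y) y) {x₀ x k : ℝ}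
    (h : ∀ y ∈ Set.uIcc x₀ x, k * (y - x₀) ^ 2 ≤ f y * (y - x₀)) :
    k * (x - x₀) ^ 2 / 2 ≤ Φ x - Φ x₀ := by
  have := sub_le_sq_of_deriv_mul_le (fun y => (hd y).fun_neg) (x₀ := x₀) (x := x) (K := -k)
    fun y hy => by linarith [h y hy]
  linarith

/-! ### The truncated Liénard field and its energy -/

/-- The hypotheses on a damped Liénard equation `x'' = F x - G x * x'` under which it has an orbit
from the saddle `p` to the sink `q`: the force is concave and vanishes at `p < q`, the potential
`∫_p^x F` returns to zero at `r`, and the damping is positive between `p` and `r`. -/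
structure IsDampedWell (F G : ℝ → ℝ) (p q r : ℝ) : Prop where
  lt_pq : p < q
  lt_qr : q < r
  smooth_force : ContDiff ℝ ∞ F
  smooth_damping : ContDiff ℝ ∞ G
  concave : ConcaveOn ℝ Set.univ F
  force_left : F p = 0
  force_right : F q = 0
  force_pos : ∀ x ∈ Set.Ioo p q, 0 < F x
  force_neg : ∀ x, q < x → F x < 0
  integral_force : ∫ s in p..r, F s = 0
  damping_pos : ∀ x ∈ Set.Icc p r, 0 < G x

/-- The nearest point to `x` in the interval `[a, b]`. -/
noncomputable def clamp (a b x : ℝ) : ℝ := max a (min b x)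

theorem clamp_mem {a b : ℝ} (h : a ≤ b) (x : ℝ) : clamp a b x ∈ Set.Icc a b :=
  ⟨le_max_left _ _, max_le h (min_le_left _ _)⟩

theorem clamp_of_mem {a b x : ℝ} (h : x ∈ Set.Icc a b) : clamp a b x = x := by
  rw [clamp, min_eq_right h.2, max_eq_right h.1]

theorem clamp_of_le {a b x : ℝ} (h : a ≤ b) (hx : x ≤ a) : clamp a b x = a := by
  rw [clamp, min_eq_right (hx.trans h), max_eq_left hx]

theorem lipschitzWith_clamp (a b : ℝ) : LipschitzWith 1 (clamp a b) :=
  (LipschitzWith.id.const_min b).const_max a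

theorem continuous_clamp (a b : ℝ) : Continuous (clamp a b) := (lipschitzWith_clamp a b).continuous

/-- The phase-plane field of `x'' = F x - G x * x'`, evaluated at the nearest point of the box
`[p, r] × [-V, V]`, which makes it bounded and globally Lipschitz. -/
noncomputable def truncField (F G : ℝ → ℝ) (p r V : ℝ) (z : ℝ × ℝ) : ℝ × ℝ :=
  (clamp (-V) V z.2, F (clamp p r z.1) - G (clamp p r z.1) * clamp (-V) V z.2)

/-- The potential of the truncated force; `-potential` is the potential energy. -/
noncomputable def potential (F : ℝ → ℝ) (p r x : ℝ) : ℝ := ∫ s in p..x, F (clamp p r s)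

/-- The kinetic energy that matches the velocity truncated at `±V`; it equals `v ^ 2 / 2` for
`|v| ≤ V` and grows linearly beyond. -/
noncomputable def kinetic (V v : ℝ) : ℝ := ∫ s in (0 : ℝ)..v, clamp (-V) V s

theorem hasDerivAt_kinetic (V v : ℝ) : HasDerivAt (kinetic V) (clamp (-V) V v) v :=
  ((continuous_clamp (-V) V).integral_hasStrictDerivAt 0 v).hasDerivAt

theorem kinetic_of_abs_le {V v : ℝ} (hv : |v| ≤ V) : kinetic V v = v ^ 2 / 2 := by
  have hv' := abs_le.1 hv
  have : kinetic V v = ∫ s in (0 : ℝ)..v, s := by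
    refine intervalIntegral.integral_congr fun s hs => clamp_of_mem ?_
    rcases Set.mem_uIcc.1 hs with h | h <;> constructor <;> linarith [h.1, h.2, abs_nonneg v]
  rw [this, integral_id]
  ring

theorem kinetic_nonneg {V : ℝ} (hV : 0 ≤ V) (v : ℝ) :
    0 ≤ kinetic V v ∧ (V ≤ |v| → V ^ 2 / 2 ≤ kinetic V v) := by
  have hder : ∀ v, deriv (kinetic V) v = clamp (-V) V v := fun v => (hasDerivAt_kinetic V v).deriv
  have hd : Differentiable ℝ (kinetic V) := fun v => (hasDerivAt_kinetic V v).differentiableAt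
  have hmono : MonotoneOn (kinetic V) (Set.Ici 0) := by
    refine monotoneOn_of_deriv_nonneg (convex_Ici 0) hd.continuous.continuousOn
      hd.differentiableOn fun x hx => ?_
    rw [interior_Ici] at hx
    rw [hder]
    exact le_max_of_le_right (le_min hV (le_of_lt hx))
  have hanti : AntitoneOn (kinetic V) (Set.Iic 0) := by
    refine antitoneOn_of_deriv_nonpos (convex_Iic 0) hd.continuous.continuousOn
      hd.differentiableOn fun x hx => ?_
    rw [interior_Iic] at hx
    rw [hder]
    exact max_le (by linarith) ((min_le_right _ _).trans (le_of_lt hx))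
  have h0 : kinetic V 0 = 0 := by simp [kinetic]
  have hp : kinetic V V = V ^ 2 / 2 := kinetic_of_abs_le (abs_of_nonneg hV).le
  have hn : kinetic V (-V) = V ^ 2 / 2 := by
    rw [kinetic_of_abs_le (by rw [abs_neg, abs_of_nonneg hV])]; ring
  rcases le_total 0 v with hv | hv
  · refine ⟨h0 ▸ hmono Set.self_mem_Ici hv hv, fun h => ?_⟩
    rw [abs_of_nonneg hv] at h
    exact hp ▸ hmono hV hv h
  · refine ⟨h0 ▸ hanti hv Set.self_mem_Iic hv, fun h => ?_⟩
    rw [abs_of_nonpos hv] at h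
    exact hn ▸ hanti hv (by simpa using hV) (by linarith)

namespace IsDampedWell

variable {F G : ℝ → ℝ} {p q r : ℝ}

theorem lt_pr (h : IsDampedWell F G p q r) : p < r := h.lt_pq.trans h.lt_qr

theorem exists_lipschitz_truncField (h : IsDampedWell F G p q r) {V : ℝ} (hV : 0 ≤ V) :
    ∃ K M : ℝ≥0, LipschitzWith K (truncField F G p r V) ∧ ∀ z, ‖truncField F G p r V z‖ ≤ M := by
  set X : ℝ × ℝ → ℝ × ℝ := fun z => (z.2, F z.1 - G z.1 * z.2) with hX
  have hF := h.smooth_force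
  have hG := h.smooth_damping
  have hXs : ContDiff ℝ ∞ X := by fun_prop
  set B : Set (ℝ × ℝ) := Set.Icc p r ×ˢ Set.Icc (-V) V with hB
  have hBc : IsCompact B := isCompact_Icc.prod isCompact_Icc
  set π : ℝ × ℝ → ℝ × ℝ := fun z => (clamp p r z.1, clamp (-V) V z.2) with hπ
  have hπB : ∀ z, π z ∈ B := fun z =>
    ⟨clamp_mem h.lt_pr.le _, clamp_mem (by linarith) _⟩
  have hπL : LipschitzWith 1 π := by
    have := ((lipschitzWith_clamp p r).comp LipschitzWith.prod_fst).prodMk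
      ((lipschitzWith_clamp (-V) V).comp LipschitzWith.prod_snd)
    simpa [Function.comp_def] using this
  obtain ⟨K, hK⟩ := ((hXs.of_le (by simp)).locallyLipschitz.locallyLipschitzOn
    (s := B)).exists_lipschitzOnWith_of_compact hBc
  obtain ⟨M, hM⟩ := hBc.exists_bound_of_continuousOn hXs.continuous.continuousOn
  refine ⟨K, M.toNNReal, ?_, fun z => (hM _ (hπB z)).trans (Real.le_coe_toNNReal M)⟩
  have := hK.comp (lipschitzOnWith_univ.2 hπL) (fun z _ => hπB z)
  rw [mul_one, lipschitzOnWith_univ] at this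
  exact this

theorem continuous_truncForce (h : IsDampedWell F G p q r) :
    Continuous fun x => F (clamp p r x) :=
  h.smooth_force.continuous.comp (continuous_clamp p r)

theorem hasDerivAt_potential (h : IsDampedWell F G p q r) (x : ℝ) :
    HasDerivAt (potential F p r) (F (clamp p r x)) x :=
  (h.continuous_truncForce.integral_hasStrictDerivAt p x).hasDerivAt

theorem potential_left (F : ℝ → ℝ) (p r : ℝ) : potential F p r p = 0 := by simp [potential]

theorem potential_right (h : IsDampedWell F G p q r) : potential F p r r = 0 := by
  rw [← h.integral_force]
  refine intervalIntegral.integral_congr fun s hs => ?_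
  rw [Set.uIcc_of_le h.lt_pr.le] at hs
  simp only [clamp_of_mem hs]

theorem strictMonoOn_potential (h : IsDampedWell F G p q r) :
    StrictMonoOn (potential F p r) (Set.Icc p q) := by
  refine strictMonoOn_of_deriv_pos (convex_Icc _ _)
    (fun x _ => (h.hasDerivAt_potential x).continuousAt.continuousWithinAt) fun x hx => ?_
  rw [interior_Icc] at hx
  rw [(h.hasDerivAt_potential x).deriv, clamp_of_mem ⟨hx.1.le, hx.2.le.trans h.lt_qr.le⟩]
  exact h.force_pos x hx

theorem strictAntiOn_potential (h : IsDampedWell F G p q r) :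
    StrictAntiOn (potential F p r) (Set.Ici q) := by
  refine strictAntiOn_of_deriv_neg (convex_Ici _)
    (fun x _ => (h.hasDerivAt_potential x).continuousAt.continuousWithinAt) fun x hx => ?_
  rw [interior_Ici] at hx
  rw [(h.hasDerivAt_potential x).deriv]
  refine h.force_neg _ (lt_max_of_lt_right (lt_min h.lt_qr hx))

theorem potential_of_le (h : IsDampedWell F G p q r) {x : ℝ} (hx : x ≤ p) :
    potential F p r x = 0 := by
  have : potential F p r x = ∫ _ in p..x, (0 : ℝ) := by
    refine intervalIntegral.integral_congr fun s hs => ?_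
    rw [Set.uIcc_of_ge hx] at hs
    simp only [clamp_of_le h.lt_pr.le hs.2, h.force_left]
  simpa using this

/-- The truncated potential is positive exactly on `(p, r)`. -/
theorem mem_Ioo_of_potential_pos (h : IsDampedWell F G p q r) {x : ℝ}
    (hx : 0 < potential F p r x) : x ∈ Set.Ioo p r := by
  refine ⟨?_, ?_⟩
  · by_contra! hle
    exact hx.ne' (h.potential_of_le hle)
  · by_contra! hle
    have := h.strictAntiOn_potential.antitoneOn h.lt_qr.le (h.lt_qr.le.trans hle) hle
    rw [h.potential_right] at this
    linarith

theorem potential_pos (h : IsDampedWell F G p q r) {x : ℝ} (hx : x ∈ Set.Ioo p r) :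
    0 < potential F p r x := by
  rcases le_total x q with hxq | hxq
  · have := h.strictMonoOn_potential (Set.left_mem_Icc.2 h.lt_pq.le) ⟨hx.1.le, hxq⟩ hx.1
    rwa [potential_left] at this
  · have := h.strictAntiOn_potential hxq h.lt_qr.le hx.2
    rwa [h.potential_right] at this

theorem potential_le (h : IsDampedWell F G p q r) (x : ℝ) :
    potential F p r x ≤ potential F p r q := by
  rcases le_total x q with hxq | hxq
  · rcases le_total p x with hpx | hpx
    · exact h.strictMonoOn_potential.monotoneOn ⟨hpx, hxq⟩ (Set.right_mem_Icc.2 h.lt_pq.le) hxq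
    · rw [h.potential_of_le hpx]
      exact (h.potential_pos ⟨h.lt_pq, h.lt_qr⟩).le
  · exact h.strictAntiOn_potential.antitoneOn Set.self_mem_Ici hxq hxq

/-- The damping dissipates the energy of the truncated system. -/
theorem antitone_energy (h : IsDampedWell F G p q r) {V : ℝ} {z : ℝ → ℝ × ℝ}
    (hz : ∀ t, HasDerivAt z (truncField F G p r V (z t)) t) :
    Antitone fun t => kinetic V (z t).2 - potential F p r (z t).1 := by
  have hd : ∀ t, HasDerivAt (fun t => kinetic V (z t).2 - potential F p r (z t).1)
      (-(G (clamp p r (z t).1) * clamp (-V) V (z t).2 ^ 2)) t := by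
    intro t
    have h1 := (hasDerivAt_kinetic V (z t).2).comp t (hz t).snd
    have h2 := (h.hasDerivAt_potential (z t).1).comp t (hz t).fst
    refine (h1.fun_sub h2).congr_deriv ?_
    simp only [truncField]
    ring
  refine antitone_of_deriv_nonpos (fun t => (hd t).differentiableAt) fun t => ?_
  rw [(hd t).deriv]
  have := h.damping_pos _ (clamp_mem h.lt_pr.le (z t).1)
  exact neg_nonpos.2 (by positivity)

/-- Negative energy confines a state to the region where the truncation is inactive. -/
theorem mem_of_energy_neg (h : IsDampedWell F G p q r) {V : ℝ} (hV : 0 ≤ V)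
    (hVq : 2 * potential F p r q ≤ V ^ 2) {x v : ℝ}
    (hE : kinetic V v - potential F p r x < 0) :
    x ∈ Set.Ioo p r ∧ |v| < V ∧ v ^ 2 / 2 ≤ potential F p r x := by
  have h1 := kinetic_nonneg hV v
  have hv : |v| < V := by
    by_contra! hle
    linarith [h1.2 hle, h.potential_le x]
  refine ⟨h.mem_Ioo_of_potential_pos (by linarith [h1.1]), hv, ?_⟩
  rw [kinetic_of_abs_le hv.le] at hE
  linarith

theorem truncField_eq {V : ℝ} {z : ℝ × ℝ} (h1 : z.1 ∈ Set.Icc p r) (h2 : |z.2| ≤ V) :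
    truncField F G p r V z = (z.2, F z.1 - G z.1 * z.2) := by
  rw [truncField, clamp_of_mem h1, clamp_of_mem (abs_le.1 h2)]

/-! ### An entire orbit emanating from the saddle -/

/-- A concave force lies above its chord from the saddle `p` to `m`. -/
theorem chord_le_force (h : IsDampedWell F G p q r) {m x : ℝ} (hm : p < m)
    (hx : x ∈ Set.Icc p m) : F m / (m - p) * (x - p) ≤ F x := by
  have hmp : 0 < m - p := by linarith
  have h1 := h.concave.2 (Set.mem_univ p) (Set.mem_univ m)
    (div_nonneg (by linarith [hx.2]) hmp.le : 0 ≤ (m - x) / (m - p))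
    (div_nonneg (by linarith [hx.1]) hmp.le : 0 ≤ (x - p) / (m - p))
    (by field_simp; ring)
  have h2 : ((m - x) / (m - p)) • p + ((x - p) / (m - p)) • m = x := by
    simp only [smul_eq_mul]
    field_simp
    ring
  rw [h2, h.force_left] at h1
  simp only [smul_eq_mul, mul_zero, zero_add] at h1
  calc F m / (m - p) * (x - p) = (x - p) / (m - p) * F m := by ring
    _ ≤ F x := h1

theorem sq_le_potential (h : IsDampedWell F G p q r) {m x : ℝ} (hm : m ∈ Set.Ioo p q)
    (hx : x ∈ Set.Icc p m) : F m / (m - p) * (x - p) ^ 2 / 2 ≤ potential F p r x := by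
  have := sq_le_sub_of_le_deriv_mul h.hasDerivAt_potential (x₀ := p) (x := x)
    (k := F m / (m - p)) fun y hy => by
      rw [Set.uIcc_of_le hx.1] at hy
      rw [clamp_of_mem ⟨hy.1, hy.2.trans (hx.2.trans (hm.2.le.trans h.lt_qr.le))⟩]
      nlinarith [h.chord_le_force hm.1 ⟨hy.1, hy.2.trans hx.2⟩, hy.1]
  rwa [potential_left, sub_zero] at this

/-- The half-plane `v ≥ α (x - p)` is forward invariant to the left of `m`, provided
`α (G + α)` does not exceed the slope of the chord of `F` over `[p, m]`. -/
theorem cone_invariant (h : IsDampedWell F G p q r) {V α m : ℝ} (hm : m ∈ Set.Ioo p q)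
    (hα : ∀ x ∈ Set.Icc p r, α * (G x + α) ≤ F m / (m - p)) {z : ℝ → ℝ × ℝ}
    (hz : ∀ t, HasDerivAt z (truncField F G p r V (z t)) t) {s b : ℝ}
    (hD : ∀ t ∈ Set.Icc s b, (z t).1 ∈ Set.Icc p m ∧ |(z t).2| ≤ V)
    (hs : α * ((z s).1 - p) ≤ (z s).2) :
    ∀ t ∈ Set.Icc s b, α * ((z t).1 - p) ≤ (z t).2 := by
  have hzc : Continuous z := continuous_iff_continuousAt.2 fun t => (hz t).continuousAt
  have hk : Continuous fun t => G (clamp p r (z t).1) + α :=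
    ((h.smooth_damping.continuous.comp (continuous_clamp p r)).comp hzc.fst).add continuous_const
  have hz1 : ∀ t, HasDerivAt (fun t => (z t).1) (truncField F G p r V (z t)).1 t :=
    fun t => (hz t).fst
  have hz2 : ∀ t, HasDerivAt (fun t => (z t).2) (truncField F G p r V (z t)).2 t :=
    fun t => (hz t).snd
  have := nonneg_of_neg_mul_le_deriv (w := fun t => (z t).2 - α * ((z t).1 - p))
    (w' := fun t => (truncField F G p r V (z t)).2 - α * (truncField F G p r V (z t)).1) hk
    (fun t => (hz2 t).fun_sub (((hz1 t).sub_const p).const_mul α)) (s := s) (b := b)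
    (by linarith) ?_
  · intro t ht
    linarith [this t ht]
  · intro t ht
    obtain ⟨h1, h2⟩ := hD t ht
    have h1' : (z t).1 ∈ Set.Icc p r := ⟨h1.1, h1.2.trans (hm.2.le.trans h.lt_qr.le)⟩
    have h3 := h.chord_le_force hm.1 h1
    have h4 := mul_le_mul_of_nonneg_right (hα _ h1') (sub_nonneg.2 h1.1)
    rw [truncField_eq h1' h2, clamp_of_mem h1']
    simp only
    nlinarith

/-- Orbits of the truncated field that follow the unstable direction of the saddle during a time
interval of length at least `T` before they reach the line `x = m`. They start on the line
`v = α (x - p)` at a small distance `ε` from the saddle. -/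
theorem exists_long_orbit (h : IsDampedWell F G p q r) {V α m : ℝ} (hm : m ∈ Set.Ioo p q)
    (hV : 0 < V) (hVq : 2 * potential F p r q ≤ V ^ 2) (hα0 : 0 < α)
    (hα : ∀ x ∈ Set.Icc p r, α * (G x + α) ≤ F m / (m - p)) {T : ℝ} (hT : 0 ≤ T) :
    ∃ z : ℝ → ℝ × ℝ, (∀ t, HasDerivAt z (truncField F G p r V (z t)) t) ∧ (z 0).1 = m ∧
      (∀ t, -T ≤ t → (z t).1 ∈ Set.Icc p r ∧ |(z t).2| ≤ V ∧
        (z t).2 ^ 2 / 2 ≤ potential F p r (z t).1) ∧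
      ∀ t ∈ Set.Icc (-T) 0, (z t).1 ≤ m ∧ α * ((z t).1 - p) ≤ (z t).2 := by
  obtain ⟨K, M, hK, hM⟩ := h.exists_lipschitz_truncField (V := V) hV.le
  have hmp : 0 < m - p := by linarith [hm.1]
  -- `ε` is so small that Grönwall's inequality forbids reaching `x = m` before time `T`.
  set B : ℝ := (1 + α) * Real.exp (K * T) with hB
  have hB1 : 1 ≤ B := by
    have : 1 ≤ Real.exp (K * T) := Real.one_le_exp (by positivity)
    nlinarith
  set ε : ℝ := (m - p) / (2 * B) with hε
  have hε0 : 0 < ε := by positivity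
  have hεB : ε * B < m - p := by
    have : ε * B = (m - p) / 2 := by rw [hε]; field_simp
    linarith
  have hεm : ε < m - p := by nlinarith
  obtain ⟨y, hy0, hy⟩ := exists_hasDerivAt_of_lipschitz_of_bounded hK hM (p + ε, α * ε)
  have hyc : Continuous y := continuous_iff_continuousAt.2 fun t => (hy t).continuousAt
  have hpI : p ∈ Set.Icc p r := Set.left_mem_Icc.2 h.lt_pr.le
  -- The initial energy is negative because `α ^ 2` is less than the chord slope.
  have hE0 : kinetic V (y 0).2 - potential F p r (y 0).1 < 0 := by
    have h1 : p + ε ∈ Set.Icc p m := ⟨by linarith, by linarith⟩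
    have h2 := h.sq_le_potential hm h1
    have h3 : α ^ 2 < F m / (m - p) := by
      have := h.damping_pos p hpI
      nlinarith [hα p hpI]
    have h4 := mul_lt_mul_of_pos_right h3 (pow_pos hε0 2)
    have h5 := h.potential_le (p + ε)
    have h6 : |α * ε| ≤ V := by
      refine abs_le_of_sq_le_sq ?_ hV.le
      rw [add_sub_cancel_left] at h2
      nlinarith
    rw [hy0]
    simp only
    rw [kinetic_of_abs_le h6]
    rw [add_sub_cancel_left] at h2
    nlinarith
  have hD : ∀ t, 0 ≤ t → (y t).1 ∈ Set.Ioo p r ∧ |(y t).2| < V ∧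
      (y t).2 ^ 2 / 2 ≤ potential F p r (y t).1 := fun t ht =>
    h.mem_of_energy_neg hV.le hVq ((h.antitone_energy hy ht).trans_lt hE0)
  have hcone : ∀ b, (∀ t ∈ Set.Icc 0 b, (y t).1 ≤ m) →
      ∀ t ∈ Set.Icc 0 b, α * ((y t).1 - p) ≤ (y t).2 := by
    intro b hb
    refine h.cone_invariant hm hα hy (fun t ht => ?_) (by rw [hy0]; simp)
    exact ⟨⟨(hD t ht.1).1.1.le, hb t ht⟩, (hD t ht.1).2.1.le⟩
  have hreach : ∃ t, 0 ≤ t ∧ m ≤ (y t).1 := by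
    by_contra! hcon
    set b : ℝ := (m - p) / (α * ε) with hb
    have hb0 : 0 ≤ b := by positivity
    have hcb := hcone b fun t ht => (hcon t ht.1).le
    have hy1 : ∀ t, HasDerivAt (fun t => (y t).1) (truncField F G p r V (y t)).1 t :=
      fun t => (hy t).fst
    have hexp : ∀ t, HasDerivAt (fun t => (y t).1 - p - ε * Real.exp (α * t))
        ((truncField F G p r V (y t)).1 - ε * (Real.exp (α * t) * α)) t := fun t =>
      ((hy1 t).sub_const p).fun_sub (((hasDerivAt_const_mul α).exp).const_mul ε)
    have hgrow := nonneg_of_neg_mul_le_deriv (continuous_const (y := -α)) hexp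
      (s := 0) (b := b) (by simp [hy0]) (fun t ht => by
        have h1 := hcb t ht
        obtain ⟨h2, h3, -⟩ := hD t ht.1
        rw [truncField_eq ⟨h2.1.le, h2.2.le⟩ h3.le]
        simp only
        linarith) b ⟨hb0, le_rfl⟩
    have h1 := hcon b hb0
    have h2 := Real.add_one_le_exp (α * b)
    have h3 : ε * (α * b) = m - p := by rw [hb]; field_simp
    nlinarith
  -- The first time at which the orbit reaches `x = m`.
  obtain ⟨τ, ⟨hτ0, hτm⟩, hτmin⟩ : ∃ τ, IsLeast {t | 0 ≤ t ∧ m ≤ (y t).1} τ := by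
    have hcl : IsClosed {t | 0 ≤ t ∧ m ≤ (y t).1} :=
      isClosed_Ici.inter (isClosed_le continuous_const hyc.fst)
    have hbdd : BddBelow {t | 0 ≤ t ∧ m ≤ (y t).1} := ⟨0, fun t ht => ht.1⟩
    exact ⟨_, hcl.csInf_mem hreach hbdd, fun t ht => csInf_le hbdd ht⟩
  have hlt : ∀ t, 0 ≤ t → t < τ → (y t).1 < m := by
    intro t ht htτ
    by_contra! hle
    exact absurd (hτmin ⟨ht, hle⟩) (not_le.2 htτ)
  have hτeq : (y τ).1 = m := by
    refine le_antisymm ?_ hτm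
    by_contra! hgt
    have hmem : m ∈ Set.Icc (y 0).1 (y τ).1 := by
      rw [hy0]
      exact ⟨by simp only; linarith, hgt.le⟩
    obtain ⟨t, ht, htm⟩ := intermediate_value_Icc hτ0 hyc.fst.continuousOn hmem
    rcases ht.2.eq_or_lt with rfl | h1
    · exact hgt.ne' htm
    · exact absurd htm (hlt t ht.1 h1).ne
  have hle : ∀ t ∈ Set.Icc 0 τ, (y t).1 ≤ m := by
    intro t ht
    rcases ht.2.eq_or_lt with rfl | h1
    · exact hτeq.le
    · exact (hlt t ht.1 h1).le
  have hTτ : T ≤ τ := by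
    by_contra! hlt
    have heq : ∀ t : ℝ, HasDerivAt (fun _ : ℝ => ((p, 0) : ℝ × ℝ))
        (truncField F G p r V (p, 0)) t := by
      intro t
      rw [truncField_eq hpI (by simpa using hV.le)]
      simpa [h.force_left] using! hasDerivAt_const t ((p, 0) : ℝ × ℝ)
    have h1 := dist_le_of_hasDerivAt hK hy heq τ
    have h2 : m - p ≤ dist (y τ) (p, 0) := by
      rw [Prod.dist_eq, Real.dist_eq, hτeq]
      exact (le_abs_self _).trans (le_max_left _ _)
    have h3 : dist (y 0) ((p, 0) : ℝ × ℝ) ≤ (1 + α) * ε := by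
      rw [hy0, Prod.dist_eq, Real.dist_eq, Real.dist_eq]
      refine max_le ?_ ?_
      · simp only [add_sub_cancel_left]
        rw [abs_of_pos hε0]
        nlinarith
      · simp only [sub_zero]
        rw [abs_of_pos (by positivity)]
        nlinarith
    have h4 : Real.exp (K * |τ|) ≤ Real.exp (K * T) := by
      rw [abs_of_nonneg hτ0]
      gcongr
    have h5 : m - p ≤ (1 + α) * ε * Real.exp (K * T) :=
      h2.trans (h1.trans (mul_le_mul h3 h4 (Real.exp_pos _).le (by positivity)))
    have h6 : ε * B = (1 + α) * ε * Real.exp (K * T) := by rw [hB]; ring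
    linarith
  refine ⟨fun t => y (t + τ), fun t => (hy (t + τ)).comp_add_const t τ, by simpa using hτeq,
    fun t ht => ?_, fun t ht => ?_⟩
  · obtain ⟨h1, h2, h3⟩ := hD (t + τ) (by linarith)
    exact ⟨⟨h1.1.le, h1.2.le⟩, h2.le, h3⟩
  · have htτ : t + τ ∈ Set.Icc 0 τ := ⟨by linarith [ht.1], by linarith [ht.2]⟩
    exact ⟨hle _ htτ, hcone τ hle _ htτ⟩

/-- An entire orbit that crosses `x = m` at time `0` and stays in the cone `v ≥ α (x - p)` at all
earlier times. By continuous dependence the admissible velocities at time `0` for longer and longer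
past intervals form a decreasing sequence of nonempty compact sets. -/
theorem exists_entire_orbit (h : IsDampedWell F G p q r) :
    ∃ m ∈ Set.Ioo p q, ∃ α > 0, ∃ x v : ℝ → ℝ, (∀ t, HasDerivAt x (v t) t) ∧
      (∀ t, HasDerivAt v (F (x t) - G (x t) * v t) t) ∧ x 0 = m ∧
      (∀ t, x t ∈ Set.Icc p r) ∧ (∀ t, v t ^ 2 / 2 ≤ potential F p r (x t)) ∧
      ∀ t ≤ 0, x t ≤ m ∧ α * (x t - p) ≤ v t := by
  set m : ℝ := (p + q) / 2 with hm_def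
  have hm : m ∈ Set.Ioo p q := by constructor <;> linarith [h.lt_pq]
  have hmp : 0 < m - p := by linarith [hm.1]
  have hc : 0 < F m / (m - p) := div_pos (h.force_pos m hm) hmp
  obtain ⟨g, hg⟩ := isCompact_Icc.exists_bound_of_continuousOn
    (h.smooth_damping.continuous.continuousOn (s := Set.Icc p r))
  have hg0 : 0 ≤ g := (norm_nonneg _).trans (hg p (Set.left_mem_Icc.2 h.lt_pr.le))
  set α : ℝ := min 1 (F m / (m - p) / (g + 1)) with hα_def
  have hα0 : 0 < α := lt_min one_pos (by positivity)
  have hα : ∀ x ∈ Set.Icc p r, α * (G x + α) ≤ F m / (m - p) := by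
    intro x hx
    have h1 : G x ≤ g := (le_abs_self _).trans (hg x hx)
    have h2 : α ≤ 1 := min_le_left _ _
    have h3 : α * (g + 1) ≤ F m / (m - p) := by
      rw [← le_div_iff₀ (by positivity)]
      exact min_le_right _ _
    nlinarith
  set V : ℝ := 1 + 2 * potential F p r q with hV_def
  have hΦq : 0 < potential F p r q := h.potential_pos ⟨h.lt_pq, h.lt_qr⟩
  have hV : 0 < V := by positivity
  have hVq : 2 * potential F p r q ≤ V ^ 2 := by nlinarith
  obtain ⟨K, M, hK, hM⟩ := h.exists_lipschitz_truncField (V := V) hV.le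
  choose φ hφ0 hφ using exists_hasDerivAt_of_lipschitz_of_bounded hK hM
  have huniq : ∀ z : ℝ → ℝ × ℝ, (∀ t, HasDerivAt z (truncField F G p r V (z t)) t) →
      ∀ t, z t = φ (z 0) t := by
    intro z hz t
    have := dist_le_of_hasDerivAt hK hz (hφ (z 0)) t
    rw [hφ0, dist_self, zero_mul] at this
    exact dist_le_zero.1 this
  have hcont : ∀ t, Continuous fun x => φ x t := by
    intro t
    refine (LipschitzWith.of_dist_le_mul (K := (Real.exp (K * |t|)).toNNReal)
      fun x y => ?_).continuous
    have := dist_le_of_hasDerivAt hK (hφ x) (hφ y) t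
    rw [hφ0, hφ0] at this
    rw [Real.coe_toNNReal _ (Real.exp_pos _).le, mul_comm]
    exact this
  have hΦc : Continuous (potential F p r) :=
    continuous_iff_continuousAt.2 fun x => (h.hasDerivAt_potential x).continuousAt
  set D : Set (ℝ × ℝ) := {z | z.1 ∈ Set.Icc p r ∧ |z.2| ≤ V ∧
    z.2 ^ 2 / 2 ≤ potential F p r z.1} with hD
  have hDc : IsClosed D :=
    (isClosed_Icc.preimage continuous_fst).inter
      ((isClosed_le continuous_snd.abs continuous_const).inter
        (isClosed_le ((continuous_snd.pow 2).div_const 2) (hΦc.comp continuous_fst)))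
  set B : Set (ℝ × ℝ) := {z | z.1 ≤ m ∧ α * (z.1 - p) ≤ z.2} with hB
  have hBc : IsClosed B :=
    (isClosed_le continuous_fst continuous_const).inter
      (isClosed_le (continuous_const.mul (continuous_fst.sub continuous_const)) continuous_snd)
  set S : ℕ → Set ℝ := fun n => Set.Icc (-V) V ∩
    ((⋂ t ∈ Set.Ici (-(n : ℝ)), (fun v => φ (m, v) t) ⁻¹' D) ∩
      ⋂ t ∈ Set.Icc (-(n : ℝ)) 0, (fun v => φ (m, v) t) ⁻¹' B) with hS
  have hφm : ∀ t, Continuous fun v => φ (m, v) t := fun t =>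
    (hcont t).comp (continuous_const.prodMk continuous_id)
  have hScl : ∀ n, IsClosed (S n) := fun n =>
    isClosed_Icc.inter ((isClosed_biInter fun t _ => hDc.preimage (hφm t)).inter
      (isClosed_biInter fun t _ => hBc.preimage (hφm t)))
  have hSne : ∀ n, (S n).Nonempty := by
    intro n
    obtain ⟨z, hz, hzm, hzD, hzB⟩ := h.exists_long_orbit hm hV hVq hα0 hα n.cast_nonneg
    have hz0 : z 0 = (m, (z 0).2) := Prod.ext hzm rfl
    have hzφ : ∀ t, φ (m, (z 0).2) t = z t := fun t => by rw [← hz0, ← huniq z hz t]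
    refine ⟨(z 0).2, abs_le.1 (hzD 0 (by simp)).2.1, ?_, ?_⟩
    · refine Set.mem_iInter₂.2 fun t ht => ?_
      rw [Set.mem_preimage, hzφ]
      exact hzD t ht
    · refine Set.mem_iInter₂.2 fun t ht => ?_
      rw [Set.mem_preimage, hzφ]
      exact hzB t ht
  have hSanti : ∀ n, S (n + 1) ⊆ S n := by
    intro n v hv
    refine ⟨hv.1, Set.mem_iInter₂.2 fun t ht => ?_, Set.mem_iInter₂.2 fun t ht => ?_⟩
    · refine Set.mem_iInter₂.1 hv.2.1 t ?_
      have : -(n : ℝ) ≤ t := ht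
      simp only [Set.mem_Ici, Nat.cast_add, Nat.cast_one]
      linarith
    · refine Set.mem_iInter₂.1 hv.2.2 t ⟨?_, ht.2⟩
      push_cast
      linarith [ht.1]
  obtain ⟨v₀, hv₀⟩ := IsCompact.nonempty_iInter_of_sequence_nonempty_isCompact_isClosed S hSanti
    hSne (isCompact_Icc.of_isClosed_subset (hScl 0) Set.inter_subset_left) hScl
  rw [Set.mem_iInter] at hv₀
  have hmemD : ∀ t, φ (m, v₀) t ∈ D := fun t => by
    obtain ⟨n, hn⟩ := exists_nat_ge (-t)
    exact Set.mem_iInter₂.1 (hv₀ n).2.1 t (by simp only [Set.mem_Ici]; linarith)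
  refine ⟨m, hm, α, hα0, fun t => (φ (m, v₀) t).1, fun t => (φ (m, v₀) t).2, fun t => ?_,
    fun t => ?_, by simp only [hφ0], fun t => (hmemD t).1, fun t => (hmemD t).2.2, fun t ht => ?_⟩
  · have := (hφ (m, v₀) t).fst
    rwa [truncField_eq (hmemD t).1 (hmemD t).2.1] at this
  · have := (hφ (m, v₀) t).snd
    rwa [truncField_eq (hmemD t).1 (hmemD t).2.1] at this
  · obtain ⟨n, hn⟩ := exists_nat_ge (-t)
    exact Set.mem_iInter₂.1 (hv₀ n).2.2 t ⟨by linarith, ht⟩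

variable {F G : ℝ → ℝ} {p q r : ℝ}

/-! ### Exponential convergence at both ends -/

/-- Beyond `a ∈ (p, q)` the force pushes towards `q` at least as strongly as the spring given by
the chord of the concave function `F` over `[a, q]`. -/
theorem force_mul_le (h : IsDampedWell F G p q r) {a x : ℝ} (ha : a < q) (hx : a ≤ x) :
    F x * (x - q) ≤ -(F a / (q - a)) * (x - q) ^ 2 := by
  have hqa : 0 < q - a := by linarith
  rcases lt_trichotomy x q with hxq | rfl | hxq
  · have h1 := h.concave.2 (Set.mem_univ a) (Set.mem_univ q)
      (div_nonneg (by linarith) hqa.le : 0 ≤ (q - x) / (q - a))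
      (div_nonneg (by linarith) hqa.le : 0 ≤ (x - a) / (q - a)) (by field_simp; ring)
    have h2 : ((q - x) / (q - a)) • a + ((x - a) / (q - a)) • q = x := by
      simp only [smul_eq_mul]
      field_simp
      ring
    rw [h2, h.force_right] at h1
    simp only [smul_eq_mul, mul_zero, add_zero] at h1
    have h3 : (q - x) / (q - a) * F a = F a / (q - a) * (q - x) := by ring
    nlinarith
  · simp
  · have h1 := h.concave.slope_anti_adjacent (Set.mem_univ a) (Set.mem_univ x) ha hxq
    rw [h.force_right, sub_zero, zero_sub, div_le_iff₀ (by linarith)] at h1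
    have h3 : -F a / (q - a) = -(F a / (q - a)) := by ring
    rw [h3] at h1
    nlinarith

theorem exists_lipschitz_force (h : IsDampedWell F G p q r) :
    ∃ K > 0, ∀ x ∈ Set.Icc p r, ∀ y ∈ Set.Icc p r, |F x - F y| ≤ K * |x - y| := by
  obtain ⟨K, hK⟩ := ((h.smooth_force.of_le (by simp)).locallyLipschitz.locallyLipschitzOn
    (s := Set.Icc p r)).exists_lipschitzOnWith_of_compact isCompact_Icc
  refine ⟨K + 1, by positivity, fun x hx y hy => ?_⟩
  have := hK.dist_le_mul x hx y hy
  rw [Real.dist_eq, Real.dist_eq] at this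
  nlinarith [abs_nonneg (x - y)]

/-- Exponential departure from the saddle: in the cone `v ≥ α (x - p)` the distance to `p` grows at
rate at least `α`, and nonpositive energy bounds the velocity by a multiple of that distance. -/
theorem exists_decay_left (h : IsDampedWell F G p q r) {α m : ℝ} {x v : ℝ → ℝ}
    (hx : ∀ t, HasDerivAt x (v t) t) (hx0 : x 0 = m) (hxI : ∀ t, x t ∈ Set.Icc p r)
    (hE : ∀ t, v t ^ 2 / 2 ≤ potential F p r (x t))
    (hcone : ∀ t ≤ 0, x t ≤ m ∧ α * (x t - p) ≤ v t) :
    ∃ C, ∀ t ≤ 0, |x t - p| ≤ C * Real.exp (α * t) ∧ |v t| ≤ C * Real.exp (α * t) := by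
  obtain ⟨K, hK, hKF⟩ := h.exists_lipschitz_force
  have hpI : p ∈ Set.Icc p r := Set.left_mem_Icc.2 h.lt_pr.le
  have hmp : 0 ≤ m - p := by linarith [(hxI 0).1]
  refine ⟨(1 + √K) * (m - p), fun t ht => ?_⟩
  have hgrow : x t - p ≤ (m - p) * Real.exp (α * t) := by
    have hd : ∀ s, HasDerivAt (fun s => x s - p - (x t - p) * Real.exp (α * (s - t)))
        (v s - (x t - p) * (Real.exp (α * (s - t)) * α)) s := fun s =>
      ((hx s).sub_const p).fun_sub
        (((((hasDerivAt_id' s).sub_const t).const_mul α).exp.const_mul (x t - p)).congr_deriv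
          (by ring))
    have h1 := nonneg_of_neg_mul_le_deriv (continuous_const (y := -α)) hd (s := t) (b := 0)
      (by simp) (fun s hs => by linarith [(hcone s hs.2).2]) 0 ⟨ht, le_rfl⟩
    rw [hx0, zero_sub, mul_neg, Real.exp_neg] at h1
    have h2 : x t - p = (x t - p) * (Real.exp (α * t))⁻¹ * Real.exp (α * t) := by
      field_simp
    rw [h2]
    exact mul_le_mul_of_nonneg_right (by linarith) (Real.exp_pos _).le
  have hu : 0 ≤ x t - p := by linarith [(hxI t).1]
  have hv : |v t| ≤ √K * (x t - p) := by
    refine abs_le_of_sq_le_sq ?_ (by positivity)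
    have h1 := sub_le_sq_of_deriv_mul_le h.hasDerivAt_potential (x₀ := p) (x := x t) (K := K)
      fun y hy => by
        rw [Set.uIcc_of_le (hxI t).1] at hy
        have hyI : y ∈ Set.Icc p r := ⟨hy.1, hy.2.trans (hxI t).2⟩
        have h2 := (le_abs_self _).trans (hKF y hyI p hpI)
        rw [h.force_left, sub_zero, abs_of_nonneg (by linarith [hy.1])] at h2
        rw [clamp_of_mem hyI]
        nlinarith [hy.1]
    rw [potential_left, sub_zero] at h1
    rw [mul_pow, Real.sq_sqrt hK.le]
    linarith [hE t]
  have hsK := Real.sqrt_nonneg K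
  have hpos : 0 ≤ (m - p) * Real.exp (α * t) := by positivity
  rw [abs_of_nonneg hu]
  constructor <;> nlinarith

theorem hasDerivAt_energy (h : IsDampedWell F G p q r) {x v : ℝ → ℝ}
    (hx : ∀ t, HasDerivAt x (v t) t) (hv : ∀ t, HasDerivAt v (F (x t) - G (x t) * v t) t)
    (hxI : ∀ t, x t ∈ Set.Icc p r) (t : ℝ) :
    HasDerivAt (fun t => v t ^ 2 / 2 - potential F p r (x t)) (-(G (x t) * v t ^ 2)) t :=
  (((hv t).fun_pow 2).div_const 2 |>.fun_sub
    ((h.hasDerivAt_potential (x t)).comp t (hx t))).congr_deriv (by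
      rw [clamp_of_mem (hxI t)]; push_cast; ring)

/-- An orbit of nonpositive energy that is moving at time `0` has negative energy from then on, and
so stays away from the saddle. -/
theorem exists_forall_le_of_energy_nonpos (h : IsDampedWell F G p q r) {x v : ℝ → ℝ}
    (hx : ∀ t, HasDerivAt x (v t) t) (hv : ∀ t, HasDerivAt v (F (x t) - G (x t) * v t) t)
    (hxI : ∀ t, x t ∈ Set.Icc p r) (hE : ∀ t, v t ^ 2 / 2 ≤ potential F p r (x t))
    (hv0 : v 0 ≠ 0) : ∃ a ∈ Set.Ioo p q, ∀ t ≥ 0, a ≤ x t := by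
  have hEd := h.hasDerivAt_energy hx hv hxI
  have hEanti : Antitone fun t => v t ^ 2 / 2 - potential F p r (x t) := by
    refine antitone_of_deriv_nonpos (fun t => (hEd t).differentiableAt) fun t => ?_
    rw [(hEd t).deriv]
    have := h.damping_pos _ (hxI t)
    exact neg_nonpos.2 (by positivity)
  -- The energy is nonpositive and strictly decreasing at time `0`, hence negative there.
  have hE0 : v 0 ^ 2 / 2 - potential F p r (x 0) < 0 := by
    refine lt_of_le_of_ne (by linarith [hE 0]) fun heq => ?_
    have hmax : IsLocalMax (fun t => v t ^ 2 / 2 - potential F p r (x t)) 0 :=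
      Eventually.of_forall fun t => by
        simp only
        rw [heq]
        linarith [hE t]
    have h1 := hmax.hasDerivAt_eq_zero (hEd 0)
    have h2 := h.damping_pos _ (hxI 0)
    have h3 : 0 < G (x 0) * v 0 ^ 2 := by positivity
    linarith
  set e : ℝ := potential F p r (x 0) - v 0 ^ 2 / 2 with he
  have hpot : ∀ t ≥ 0, e ≤ potential F p r (x t) := fun t ht => by
    have := hEanti ht
    simp only at this
    nlinarith [sq_nonneg (v t)]
  obtain ⟨a, ha, hae⟩ : ∃ a ∈ Set.Ioo p q, potential F p r a < e := by
    have h1 : ∀ᶠ a in 𝓝[>] p, potential F p r a < e := by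
      refine ((h.hasDerivAt_potential p).continuousAt.continuousWithinAt).eventually_lt_const ?_
      rw [potential_left]
      linarith
    exact (Filter.Eventually.and (Ioo_mem_nhdsGT h.lt_pq) h1).exists
  refine ⟨a, ha, fun t ht => ?_⟩
  by_contra! hlt
  have := h.strictMonoOn_potential.monotoneOn
    ⟨(hxI t).1, hlt.le.trans ha.2.le⟩ ⟨ha.1.le, ha.2.le⟩ hlt.le
  linarith [hpot t ht]

/-- Exponential convergence to the sink. For an orbit that stays away from the saddle, adding a
small multiple `η` of the cross term `(x - q) v` to the energy gives a function that is comparable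
to `(x - q) ^ 2 + v ^ 2` and decays exponentially. -/
theorem exists_decay_right (h : IsDampedWell F G p q r) {x v : ℝ → ℝ}
    (hx : ∀ t, HasDerivAt x (v t) t) (hv : ∀ t, HasDerivAt v (F (x t) - G (x t) * v t) t)
    (hxI : ∀ t, x t ∈ Set.Icc p r) {a : ℝ} (ha : a ∈ Set.Ioo p q) (hxa : ∀ t ≥ 0, a ≤ x t) :
    ∃ β > 0, ∃ C, ∀ t ≥ 0, |x t - q| ≤ C * Real.exp (-(β * t)) ∧
      |v t| ≤ C * Real.exp (-(β * t)) := by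
  have hqI : q ∈ Set.Icc p r := ⟨h.lt_pq.le, h.lt_qr.le⟩
  have hEd := h.hasDerivAt_energy hx hv hxI
  set k : ℝ := F a / (q - a) with hk_def
  have hk : 0 < k := div_pos (h.force_pos a ha) (by linarith [ha.2])
  obtain ⟨K, hK, hKF⟩ := h.exists_lipschitz_force
  have hsub : ∀ t ≥ 0, ∀ y ∈ Set.uIcc q (x t), a ≤ y ∧ y ∈ Set.Icc p r := fun t ht y hy => by
    have h1 : y ∈ Set.Icc a r :=
      Set.uIcc_subset_Icc ⟨ha.2.le, h.lt_qr.le⟩ ⟨hxa t ht, (hxI t).2⟩ hy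
    exact ⟨h1.1, ha.1.le.trans h1.1, h1.2⟩
  have hlow : ∀ t ≥ 0, k * (x t - q) ^ 2 / 2 ≤ potential F p r q - potential F p r (x t) := by
    intro t ht
    have := sub_le_sq_of_deriv_mul_le h.hasDerivAt_potential (x₀ := q) (x := x t) (K := -k)
      fun y hy => by
        rw [clamp_of_mem (hsub t ht y hy).2]
        exact h.force_mul_le ha.2 (hsub t ht y hy).1
    linarith
  have hupp : ∀ t ≥ 0, potential F p r q - potential F p r (x t) ≤ K * (x t - q) ^ 2 / 2 := by
    intro t ht
    have := sq_le_sub_of_le_deriv_mul h.hasDerivAt_potential (x₀ := q) (x := x t) (k := -K)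
      fun y hy => by
        have hyI := (hsub t ht y hy).2
        rw [clamp_of_mem hyI]
        have h1 := hKF y hyI q hqI
        rw [h.force_right, sub_zero] at h1
        have h2 := mul_le_mul_of_nonneg_right h1 (abs_nonneg (y - q))
        have h3 := neg_abs_le (F y * (y - q))
        rw [abs_mul] at h3
        nlinarith [abs_mul_abs_self (y - q)]
    linarith
  obtain ⟨b, hb, hbmin⟩ := isCompact_Icc.exists_isMinOn (Set.nonempty_Icc.2 h.lt_pr.le)
    (h.smooth_damping.continuous.continuousOn (s := Set.Icc p r))
  have hγ : 0 < G b := h.damping_pos b hb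
  have hγx : ∀ t, G b ≤ G (x t) := fun t => hbmin (hxI t)
  obtain ⟨g, hg⟩ := isCompact_Icc.exists_bound_of_continuousOn
    (h.smooth_damping.continuous.continuousOn (s := Set.Icc p r))
  have hgx : ∀ t, G (x t) ≤ g := fun t => (le_abs_self _).trans (hg _ (hxI t))
  have hg0 : 0 ≤ g := (norm_nonneg _).trans (hg b hb)
  obtain ⟨η, hη, hη1, hη2⟩ : ∃ η > 0, η * (1 + g ^ 2 / (2 * k)) ≤ G b / 2 ∧ η ^ 2 ≤ k / 4 := by
    have hden : 0 < 1 + g ^ 2 / (2 * k) := by positivity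
    refine ⟨min (G b / 2 / (1 + g ^ 2 / (2 * k))) (min 1 (k / 4)), by positivity, ?_, ?_⟩
    · rw [← le_div_iff₀ hden]
      exact min_le_left _ _
    · set η := min (G b / 2 / (1 + g ^ 2 / (2 * k))) (min 1 (k / 4))
      have h0 : 0 < η := by positivity
      have h1 : η ≤ 1 := (min_le_right _ _).trans (min_le_left _ _)
      have h2 : η ≤ k / 4 := (min_le_right _ _).trans (min_le_right _ _)
      nlinarith
  set L : ℝ → ℝ := fun t =>
    v t ^ 2 / 2 - potential F p r (x t) + potential F p r q + η * ((x t - q) * v t) with hL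
  have hLd : ∀ t, HasDerivAt L (-(G (x t) * v t ^ 2) +
      η * (v t * v t + (x t - q) * (F (x t) - G (x t) * v t))) t := fun t =>
    ((hEd t).add_const _).fun_add ((((hx t).sub_const q).fun_mul (hv t)).const_mul η)
  have hLd_le : ∀ t ≥ 0, -(G (x t) * v t ^ 2) +
      η * (v t * v t + (x t - q) * (F (x t) - G (x t) * v t)) ≤
      -(G b / 2 * v t ^ 2) - η * k / 2 * (x t - q) ^ 2 := by
    intro t ht
    have h1 := h.force_mul_le ha.2 (hxa t ht)
    rw [← hk_def] at h1
    -- Young's inequality for the cross term, with weights chosen to be absorbed by `k (x - q) ^ 2`.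
    have h2 : -(G (x t) * ((x t - q) * v t)) ≤
        k / 2 * (x t - q) ^ 2 + g ^ 2 / (2 * k) * v t ^ 2 := by
      have h3 : 0 ≤ (k * (x t - q) + G (x t) * v t) ^ 2 / (2 * k) := by positivity
      have h4 : (k * (x t - q) + G (x t) * v t) ^ 2 / (2 * k) = k / 2 * (x t - q) ^ 2 +
          G (x t) * ((x t - q) * v t) + G (x t) ^ 2 / (2 * k) * v t ^ 2 := by
        field_simp
        ring
      have h5 : G (x t) ^ 2 / (2 * k) ≤ g ^ 2 / (2 * k) := by
        have := h.damping_pos _ (hxI t)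
        gcongr
        exact hgx t
      have h6 := mul_le_mul_of_nonneg_right h5 (sq_nonneg (v t))
      linarith
    have h7 := mul_le_mul_of_nonneg_left (add_le_add h1 h2) hη.le
    have h8 := mul_le_mul_of_nonneg_right hη1 (sq_nonneg (v t))
    have h9 := mul_le_mul_of_nonneg_right (hγx t) (sq_nonneg (v t))
    nlinarith
  have hcross : ∀ t, |η * ((x t - q) * v t)| ≤ v t ^ 2 / 4 + k / 4 * (x t - q) ^ 2 := by
    intro t
    have h1 := mul_le_mul_of_nonneg_right hη2 (sq_nonneg (x t - q))
    rw [abs_le]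
    constructor
    · nlinarith [sq_nonneg (v t / 2 + η * (x t - q))]
    · nlinarith [sq_nonneg (v t / 2 - η * (x t - q))]
  have hL_low : ∀ t ≥ 0, v t ^ 2 / 4 + k / 4 * (x t - q) ^ 2 ≤ L t := by
    intro t ht
    have h1 := (abs_le.1 (hcross t)).1
    have h2 := hlow t ht
    simp only [hL]
    linarith
  have hL_upp : ∀ t ≥ 0, L t ≤ v t ^ 2 + (K + k) * (x t - q) ^ 2 := by
    intro t ht
    have h1 := (abs_le.1 (hcross t)).2
    have h2 := hupp t ht
    simp only [hL]
    nlinarith [sq_nonneg (v t), sq_nonneg (x t - q), mul_nonneg hk.le (sq_nonneg (x t - q)),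
      mul_nonneg hK.le (sq_nonneg (x t - q))]
  obtain ⟨β, hβ, hβ1, hβ2⟩ : ∃ β > 0, β ≤ G b / 2 ∧ β * (K + k) ≤ η * k / 2 := by
    refine ⟨min (G b / 2) (η * k / 2 / (K + k)), by positivity, min_le_left _ _, ?_⟩
    rw [← le_div_iff₀ (by positivity)]
    exact min_le_right _ _
  have hdecay : ∀ t ≥ 0, L t ≤ L 0 * Real.exp (-(β * t)) := by
    intro t ht
    have hd : ∀ s, HasDerivAt (fun s => L 0 * Real.exp (-(β * s)) - L s)
        (L 0 * (Real.exp (-(β * s)) * -β) - (-(G (x s) * v s ^ 2) +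
          η * (v s * v s + (x s - q) * (F (x s) - G (x s) * v s)))) s := fun s =>
      (((hasDerivAt_const_mul β).fun_neg.exp).const_mul (L 0)).fun_sub (hLd s)
    have h1 := nonneg_of_neg_mul_le_deriv (continuous_const (y := β)) hd (s := 0) (b := t)
      (by simp) (fun s hs => by
        have h1 := hLd_le s hs.1
        have h2 := mul_le_mul_of_nonneg_left (hL_upp s hs.1) hβ.le
        have h3 := mul_le_mul_of_nonneg_right hβ1 (sq_nonneg (v s))
        have h4 := mul_le_mul_of_nonneg_right hβ2 (sq_nonneg (x s - q))
        nlinarith) t ⟨ht, le_rfl⟩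
    linarith
  have hL0 : 0 ≤ L 0 := le_trans (by positivity) (hL_low 0 le_rfl)
  have hsq : ∀ t, Real.exp (-(β / 2 * t)) ^ 2 = Real.exp (-(β * t)) := fun t => by
    rw [← Real.exp_nat_mul]
    congr 1
    push_cast
    ring
  refine ⟨β / 2, by positivity, √(4 * L 0) + √(4 * L 0 / k), fun t ht => ?_⟩
  have h1 := (hL_low t ht).trans (hdecay t ht)
  have hexp := Real.exp_pos (-(β / 2 * t))
  constructor
  · refine (abs_le_of_sq_le_sq (b := √(4 * L 0 / k) * Real.exp (-(β / 2 * t))) ?_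
      (by positivity)).trans ?_
    · rw [mul_pow, hsq, Real.sq_sqrt (by positivity), div_mul_eq_mul_div, le_div_iff₀ hk]
      nlinarith [sq_nonneg (v t)]
    · exact mul_le_mul_of_nonneg_right (le_add_of_nonneg_left (Real.sqrt_nonneg _)) hexp.le
  · refine (abs_le_of_sq_le_sq (b := √(4 * L 0) * Real.exp (-(β / 2 * t))) ?_
      (by positivity)).trans ?_
    · rw [mul_pow, hsq, Real.sq_sqrt (by positivity)]
      nlinarith [mul_nonneg hk.le (sq_nonneg (x t - q))]
    · exact mul_le_mul_of_nonneg_right (le_add_of_nonneg_right (Real.sqrt_nonneg _)) hexp.le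

end IsDampedWell

/-! ### Exponential decay of higher derivatives -/

/-- Two-sided exponential decay at rate `α`. -/
def ExpDecay (α : ℝ) (f : ℝ → ℝ) : Prop := ∃ C, ∀ t, |f t| ≤ C * Real.exp (-(α * |t|))

theorem ExpDecay.sub {α : ℝ} {f g : ℝ → ℝ} (hf : ExpDecay α f) (hg : ExpDecay α g) :
    ExpDecay α fun t => f t - g t := by
  obtain ⟨C, hC⟩ := hf
  obtain ⟨D, hD⟩ := hg
  refine ⟨C + D, fun t => (abs_sub _ _).trans ?_⟩
  rw [add_mul]
  exact add_le_add (hC t) (hD t)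

/-- If a bounded function has decaying derivatives of orders `1, …, n`, then so does its
composition with a smooth function. In the Faà di Bruno estimate `norm_iteratedFDeriv_comp_le` the
`i`-th derivative is compared with the `i`-th power of `B * exp (-α |t| / n)`, so that the `n`-th
power restores the full rate `α`. -/
theorem ExpDecay.iteratedDeriv_comp {H x : ℝ → ℝ} {p r α : ℝ} (hα : 0 ≤ α)
    (hH : ContDiff ℝ ∞ H) (hx : ContDiff ℝ ∞ x) (hxI : ∀ t, x t ∈ Set.Icc p r) {n : ℕ}
    (hn : 1 ≤ n) (hd : ∀ j, 1 ≤ j → j ≤ n → ExpDecay α (iteratedDeriv j x)) :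
    ExpDecay α (iteratedDeriv n (H ∘ x)) := by
  have hHb : ∀ i : ℕ, ∃ C, ∀ y ∈ Set.Icc p r, ‖iteratedFDeriv ℝ i H y‖ ≤ C := fun i =>
    isCompact_Icc.exists_bound_of_continuousOn
      (hH.continuous_iteratedFDeriv (by exact_mod_cast le_top)).continuousOn
  choose A hA using hHb
  have hC : ∀ j, ∃ C, 1 ≤ j → j ≤ n → ∀ t, |iteratedDeriv j x t| ≤ C * Real.exp (-(α * |t|)) := by
    intro j
    by_cases h : 1 ≤ j ∧ j ≤ n
    · obtain ⟨C, hC⟩ := hd j h.1 h.2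
      exact ⟨C, fun _ _ => hC⟩
    · exact ⟨0, fun h1 h2 => absurd ⟨h1, h2⟩ h⟩
  choose C hC using hC
  set A' : ℝ := ∑ i ∈ Finset.range (n + 1), |A i|
  set B : ℝ := 1 + ∑ j ∈ Finset.range (n + 1), |C j|
  have hB1 : 1 ≤ B := le_add_of_nonneg_right (Finset.sum_nonneg fun _ _ => abs_nonneg _)
  have hle : ∀ (c : ℕ → ℝ) (i : ℕ), i ≤ n → c i ≤ ∑ j ∈ Finset.range (n + 1), |c j| := fun c i hi =>
    (le_abs_self _).trans (Finset.single_le_sum (f := fun j => |c j|)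
      (fun _ _ => abs_nonneg _) (Finset.mem_range.2 (by omega)))
  have hn0 : (0 : ℝ) < n := by exact_mod_cast hn
  refine ⟨n.factorial * A' * B ^ n, fun t => ?_⟩
  have h1 := norm_iteratedFDeriv_comp_le (𝕜 := ℝ) (n := n) (C := A')
    (D := B * Real.exp (-(α * |t|) / n)) hH hx (by exact_mod_cast le_top) t
    (fun i hi => (hA i _ (hxI t)).trans (hle A i hi))
    (fun i hi1 hi => by
      rw [norm_iteratedFDeriv_eq_norm_iteratedDeriv, Real.norm_eq_abs, mul_pow, ← Real.exp_nat_mul]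
      refine (hC i hi1 hi t).trans (mul_le_mul ?_ ?_ (Real.exp_pos _).le (by positivity))
      · calc C i ≤ B := (hle C i hi).trans (le_add_of_nonneg_left zero_le_one)
          _ ≤ B ^ i := le_self_pow₀ hB1 (by omega)
      · refine Real.exp_le_exp.2 ?_
        have hi' : (i : ℝ) ≤ n := by exact_mod_cast hi
        have h0 : 0 ≤ α * |t| := by positivity
        rw [mul_div_assoc', le_div_iff₀ hn0]
        nlinarith)
  rw [norm_iteratedFDeriv_eq_norm_iteratedDeriv, Real.norm_eq_abs, mul_pow, ← Real.exp_nat_mul,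
    mul_div_cancel₀ _ hn0.ne'] at h1
  linarith

namespace IsDampedWell

variable {F G : ℝ → ℝ} {p q r : ℝ}

theorem contDiff_orbit (h : IsDampedWell F G p q r) {x v : ℝ → ℝ}
    (hx : ∀ t, HasDerivAt x (v t) t) (hv : ∀ t, HasDerivAt v (F (x t) - G (x t) * v t) t) :
    ContDiff ℝ ∞ x ∧ ContDiff ℝ ∞ v := by
  have hxd : deriv x = v := funext fun t => (hx t).deriv
  have hvd : deriv v = fun t => F (x t) - G (x t) * v t := funext fun t => (hv t).deriv
  have key : ∀ n : ℕ, ContDiff ℝ n x ∧ ContDiff ℝ n v := by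
    intro n
    induction n with
    | zero =>
      exact ⟨contDiff_zero.2 (continuous_iff_continuousAt.2 fun t => (hx t).continuousAt),
        contDiff_zero.2 (continuous_iff_continuousAt.2 fun t => (hv t).continuousAt)⟩
    | succ n ih =>
      obtain ⟨ihx, ihv⟩ := ih
      have hF : ContDiff ℝ n F := h.smooth_force.of_le (by exact_mod_cast le_top)
      have hG : ContDiff ℝ n G := h.smooth_damping.of_le (by exact_mod_cast le_top)
      push_cast
      refine ⟨contDiff_succ_iff_deriv.2 ⟨fun t => (hx t).differentiableAt, by simp, hxd ▸ ihv⟩,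
        contDiff_succ_iff_deriv.2 ⟨fun t => (hv t).differentiableAt, by simp, ?_⟩⟩
      rw [hvd]
      exact (hF.comp ihx).sub ((hG.comp ihx).mul ihv)
  exact ⟨contDiff_infty.2 fun n => (key n).1, contDiff_infty.2 fun n => (key n).2⟩

/-- All derivatives of an orbit decay once the velocity and the force along it do. With a primitive
`Γ` of `G` the equation reads `x'' = F x - (Γ x)'`, so each derivative is expressed through
derivatives of lower order of compositions of `x` with smooth functions. -/
theorem expDecay_iteratedDeriv (h : IsDampedWell F G p q r) {α : ℝ} (hα : 0 ≤ α) {x v : ℝ → ℝ}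
    (hx : ∀ t, HasDerivAt x (v t) t) (hv : ∀ t, HasDerivAt v (F (x t) - G (x t) * v t) t)
    (hxI : ∀ t, x t ∈ Set.Icc p r) (hvd : ExpDecay α v) (hFd : ExpDecay α fun t => F (x t)) :
    ∀ n, 1 ≤ n → ExpDecay α (iteratedDeriv n x) := by
  obtain ⟨hxs, -⟩ := h.contDiff_orbit hx hv
  have hx1 : deriv x = v := funext fun t => (hx t).deriv
  set Γ : ℝ → ℝ := fun y => ∫ s in p..y, G s with hΓ
  have hΓd : ∀ y, HasDerivAt Γ (G y) y := fun y =>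
    (h.smooth_damping.continuous.integral_hasStrictDerivAt p y).hasDerivAt
  have hΓs : ContDiff ℝ ∞ Γ := by
    refine contDiff_infty_iff_deriv.2 ⟨fun y => (hΓd y).differentiableAt, ?_⟩
    rw [show deriv Γ = G from funext fun y => (hΓd y).deriv]
    exact h.smooth_damping
  have hv1 : deriv v = fun t => (F ∘ x) t - deriv (Γ ∘ x) t := by
    funext t
    rw [(hv t).deriv, ((hΓd (x t)).comp t (hx t)).deriv]
    rfl
  have hstep : ∀ n, iteratedDeriv (n + 2) x =
      fun t => iteratedDeriv n (F ∘ x) t - iteratedDeriv (n + 1) (Γ ∘ x) t := by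
    intro n
    funext t
    have hsΓ : ContDiff ℝ ∞ (deriv (Γ ∘ x)) :=
      (contDiff_infty_iff_deriv.1 (hΓs.comp hxs)).2
    rw [iteratedDeriv_succ', iteratedDeriv_succ', hx1, hv1,
      iteratedDeriv_fun_sub
        ((h.smooth_force.comp hxs).contDiffAt.of_le (by exact_mod_cast le_top))
        (hsΓ.contDiffAt.of_le (by exact_mod_cast le_top)), ← iteratedDeriv_succ']
  intro n
  induction n using Nat.strong_induction_on with
  | _ n ih =>
    intro hn
    match n, hn with
    | 1, _ => rwa [iteratedDeriv_one, hx1]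
    | n + 2, _ =>
      have hlow : ∀ j, 1 ≤ j → j ≤ n + 1 → ExpDecay α (iteratedDeriv j x) := fun j h1 h2 =>
        ih j (by omega) h1
      rw [hstep]
      refine ExpDecay.sub ?_ (ExpDecay.iteratedDeriv_comp hα hΓs hxs hxI (by omega) hlow)
      rcases Nat.eq_zero_or_pos n with rfl | hn
      · rw [iteratedDeriv_zero]
        exact hFd
      · exact ExpDecay.iteratedDeriv_comp hα h.smooth_force hxs hxI hn
          fun j h1 h2 => hlow j h1 (by omega)

/-! ### The heteroclinic orbit -/

theorem exists_heteroclinic (h : IsDampedWell F G p q r) :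
    ∃ ρ : ℝ → ℝ, ContDiff ℝ ∞ ρ ∧ (∀ t, ρ t ∈ Set.Icc p r) ∧
      (∀ t, deriv (deriv ρ) t = F (ρ t) - G (ρ t) * deriv ρ t) ∧
      Tendsto ρ atBot (𝓝 p) ∧ Tendsto ρ atTop (𝓝 q) ∧
      ∃ (α : ℝ) (C : ℕ → ℝ), 0 < α ∧ (∀ m, 0 < C m) ∧
        (∀ s ≤ 0, ∀ t ≥ 0,
          Real.exp (α * |s|) * |ρ s - p| + Real.exp (α * |t|) * |ρ t - q| ≤ C 0) ∧
        (∀ m ≥ 1, ∀ t, Real.exp (α * |t|) * |iteratedDeriv m ρ t| ≤ C m) := by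
  obtain ⟨m, hm, α₁, hα₁, x, v, hx, hv, hx0, hxI, hE, hcone⟩ := h.exists_entire_orbit
  have hv0 : v 0 ≠ 0 := by
    have h1 := (hcone 0 le_rfl).2
    rw [hx0] at h1
    have : 0 < α₁ * (m - p) := mul_pos hα₁ (by linarith [hm.1])
    linarith
  obtain ⟨a, ha, hxa⟩ := h.exists_forall_le_of_energy_nonpos hx hv hxI hE hv0
  obtain ⟨β, hβ, D, hD⟩ := h.exists_decay_right hx hv hxI ha hxa
  obtain ⟨C, hC⟩ := h.exists_decay_left hx hx0 hxI hE hcone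
  set α := min α₁ β with hα_def
  have hα : 0 < α := lt_min hα₁ hβ
  set B : ℝ := |C| + |D| with hB
  have hB0 : 0 ≤ B := by positivity
  have hleft : ∀ t ≤ 0, |x t - p| ≤ B * Real.exp (-(α * |t|)) ∧
      |v t| ≤ B * Real.exp (-(α * |t|)) := by
    intro t ht
    have h1 : C * Real.exp (α₁ * t) ≤ B * Real.exp (-(α * |t|)) := by
      refine mul_le_mul ((le_abs_self C).trans (le_add_of_nonneg_right (abs_nonneg D)))
        (Real.exp_le_exp.2 ?_) (Real.exp_pos _).le hB0
      rw [abs_of_nonpos ht]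
      nlinarith [min_le_left α₁ β]
    exact ⟨(hC t ht).1.trans h1, (hC t ht).2.trans h1⟩
  have hright : ∀ t ≥ 0, |x t - q| ≤ B * Real.exp (-(α * |t|)) ∧
      |v t| ≤ B * Real.exp (-(α * |t|)) := by
    intro t ht
    have h1 : D * Real.exp (-(β * t)) ≤ B * Real.exp (-(α * |t|)) := by
      refine mul_le_mul ((le_abs_self D).trans (le_add_of_nonneg_left (abs_nonneg C)))
        (Real.exp_le_exp.2 ?_) (Real.exp_pos _).le hB0
      rw [abs_of_nonneg ht]
      nlinarith [min_le_right α₁ β]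
    exact ⟨(hD t ht).1.trans h1, (hD t ht).2.trans h1⟩
  have hvd : ExpDecay α v := ⟨B, fun t =>
    (le_total t 0).elim (fun ht => (hleft t ht).2) fun ht => (hright t ht).2⟩
  have hFd : ExpDecay α fun t => F (x t) := by
    obtain ⟨K, hK, hKF⟩ := h.exists_lipschitz_force
    refine ⟨K * B, fun t => ?_⟩
    rw [mul_assoc]
    rcases le_total t 0 with ht | ht
    · have h1 := hKF _ (hxI t) p (Set.left_mem_Icc.2 h.lt_pr.le)
      rw [h.force_left, sub_zero] at h1
      exact h1.trans (mul_le_mul_of_nonneg_left (hleft t ht).1 hK.le)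
    · have h1 := hKF _ (hxI t) q ⟨h.lt_pq.le, h.lt_qr.le⟩
      rw [h.force_right, sub_zero] at h1
      exact h1.trans (mul_le_mul_of_nonneg_left (hright t ht).1 hK.le)
  have hder := h.expDecay_iteratedDeriv hα.le hx hv hxI hvd hFd
  have hlim : Tendsto (fun t => B * Real.exp (-(α * |t|))) (cocompact ℝ) (𝓝 0) := by
    have h1 : Tendsto (fun t : ℝ => α * |t|) (cocompact ℝ) atTop :=
      (tendsto_norm_cocompact_atTop (E := ℝ)).const_mul_atTop hα
    simpa using (Real.tendsto_exp_neg_atTop_nhds_zero.comp h1).const_mul B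
  have hweight : ∀ {c y t : ℝ}, |y| ≤ c * Real.exp (-(α * |t|)) → Real.exp (α * |t|) * |y| ≤ c := by
    intro c y t hy
    rwa [Real.exp_neg, ← div_eq_mul_inv, le_div_iff₀ (Real.exp_pos _), mul_comm] at hy
  have hCm : ∀ n, ∃ c > 0, (n = 0 → c = 2 * B + 1) ∧
      (1 ≤ n → ∀ t, Real.exp (α * |t|) * |iteratedDeriv n x t| ≤ c) := by
    intro n
    rcases Nat.eq_zero_or_pos n with rfl | hn
    · exact ⟨2 * B + 1, by positivity, fun _ => rfl, fun h => absurd h (by omega)⟩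
    · obtain ⟨c, hc⟩ := hder n hn
      exact ⟨|c| + 1, by positivity, fun h => absurd h (by omega), fun _ t =>
        (hweight (hc t)).trans (by linarith [le_abs_self c])⟩
  choose c hc0 hc1 hc2 using hCm
  have hxd : deriv x = v := funext fun t => (hx t).deriv
  refine ⟨x, (h.contDiff_orbit hx hv).1, hxI, fun t => by rw [hxd, (hv t).deriv], ?_, ?_,
    α, c, hα, hc0, fun s hs t ht => ?_, fun m hm => hc2 m hm⟩
  · rw [tendsto_iff_dist_tendsto_zero]
    refine squeeze_zero' (Eventually.of_forall fun _ => dist_nonneg) ?_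
      (hlim.mono_left atBot_le_cocompact)
    filter_upwards [eventually_le_atBot 0] with t ht
    exact (hleft t ht).1
  · rw [tendsto_iff_dist_tendsto_zero]
    refine squeeze_zero' (Eventually.of_forall fun _ => dist_nonneg) ?_
      (hlim.mono_left atTop_le_cocompact)
    filter_upwards [eventually_ge_atTop 0] with t ht
    exact (hright t ht).1
  · rw [hc1 0 rfl]
    linarith [hweight (hleft s hs).1, hweight (hright t ht).1]

end IsDampedWell

/-! ### Application to the shallow-water profile equation -/

theorem force_eq (μ a A x : ℝ) :
    force μ a A x = a / (μ * A) * (1 - Real.exp x - A / 4 * Real.exp (-x)) := rfl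

theorem isDampedWell_force {μ a A : ℝ} (hμ : 0 < μ) (ha : 0 < a) (hA0 : 0 < A) (hA1 : A < 1)
    {G : ℝ → ℝ} (hG : ContDiff ℝ ∞ G) (hGpos : ∀ x ∈ Set.Icc (rhoMinus A) (rhoStar A), 0 < G x) :
    IsDampedWell (force μ a A) G (rhoMinus A) (rhoPlus A) (rhoStar A) := by
  obtain ⟨hm, hlt, -, -⟩ := heights hA0 hA1
  have hp : 0 < heightPlus A := hm.trans hlt
  have hstar := isEquipotential_rhoStar hA0 hA1
  have hc : 0 < a / (μ * A) := by positivity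
  have hfac : ∀ x, force μ a A x = a / (μ * A) *
      (Real.exp (-x) * ((Real.exp x - heightMinus A) * (heightPlus A - Real.exp x))) := fun x => by
    rw [force_eq, force_factor hA0 hA1]
  refine
    { lt_pq := Real.log_lt_log hm hlt
      lt_qr := (existsUnique_isEquipotential hA0 hA1).2 _ hstar
      smooth_force := ?_
      smooth_damping := hG
      concave := ?_
      force_left := ?_
      force_right := ?_
      force_pos := fun x hx => ?_
      force_neg := fun x hx => ?_
      integral_force := ?_
      damping_pos := hGpos }
  · unfold force
    fun_prop
  · have h1 : ConvexOn ℝ Set.univ fun x : ℝ => Real.exp (-x) := by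
      have := convexOn_exp.comp_linearMap (-LinearMap.id : ℝ →ₗ[ℝ] ℝ)
      simpa [Function.comp_def] using this
    have h2 : ConvexOn ℝ Set.univ fun x : ℝ => Real.exp x + A / 4 * Real.exp (-x) :=
      convexOn_exp.add (h1.smul (by positivity : 0 ≤ A / 4))
    have h3 := ((concaveOn_const (1 : ℝ) convex_univ).sub h2).smul hc.le
    refine h3.congr fun x _ => ?_
    simp only [force_eq, Pi.sub_apply, smul_eq_mul]
    ring
  · rw [hfac, rhoMinus, Real.exp_log hm]
    simp
  · rw [hfac, rhoPlus, Real.exp_log hp]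
    simp
  · have e1 : heightMinus A < Real.exp x := (Real.log_lt_iff_lt_exp hm).1 hx.1
    have e2 : Real.exp x < heightPlus A := (Real.lt_log_iff_exp_lt hp).1 hx.2
    rw [hfac]
    exact mul_pos hc (mul_pos (Real.exp_pos _) (mul_pos (by linarith) (by linarith)))
  · have e2 : heightPlus A < Real.exp x := (Real.log_lt_iff_lt_exp hp).1 hx
    rw [hfac]
    exact mul_neg_of_pos_of_neg hc (mul_neg_of_pos_of_neg (Real.exp_pos _)
      (mul_neg_of_pos_of_neg (by linarith) (by linarith)))
  · simp only [force_eq]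
    rw [intervalIntegral.integral_const_mul, hstar.2, mul_zero]

theorem contDiff_damping (μ g A : ℝ) : ContDiff ℝ ∞ (damping μ g A) := by
  unfold damping
  fun_prop

theorem antitone_damping {μ g A : ℝ} (hμ : 0 < μ) (hg : 0 ≤ g) (hA : 0 < A) :
    Antitone (damping μ g A) := by
  intro x y hxy
  unfold damping
  gcongr

end ShallowWater

theorem mainTheorem6 (μ a g A : ℝ) (hμ : 0 < μ) (ha : 0 < a) (hg : 0 ≤ g)
    (hA0 : 0 < A) (hA1 : A < 1) :
    (0 < ShallowWater.damping μ g A (ShallowWater.rhoStar A) →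
      ∃ ρ : ℝ → ℝ, ContDiff ℝ ∞ ρ ∧
        (∀ t, ρ t ∈ Set.Icc (ShallowWater.rhoMinus A) (ShallowWater.rhoStar A)) ∧
        (∀ t, deriv (deriv ρ) t =
          ShallowWater.force μ a A (ρ t) - ShallowWater.damping μ g A (ρ t) * deriv ρ t) ∧
        Tendsto ρ atBot (𝓝 (ShallowWater.rhoMinus A)) ∧
        Tendsto ρ atTop (𝓝 (ShallowWater.rhoPlus A)) ∧
        ∃ (α : ℝ) (C : ℕ → ℝ), 0 < α ∧ (∀ m, 0 < C m) ∧
          (∀ s ≤ 0, ∀ t ≥ 0,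
            Real.exp (α * |s|) * |ρ s - ShallowWater.rhoMinus A| +
              Real.exp (α * |t|) * |ρ t - ShallowWater.rhoPlus A| ≤ C 0) ∧
          (∀ m ≥ 1, ∀ t, Real.exp (α * |t|) * |iteratedDeriv m ρ t| ≤ C m)) ∧
    (ShallowWater.damping μ g A (ShallowWater.rhoMinus A) < 0 →
      ∃ ρ : ℝ → ℝ, ContDiff ℝ ∞ ρ ∧
        (∀ t, ρ t ∈ Set.Icc (ShallowWater.rhoMinus A) (ShallowWater.rhoStar A)) ∧
        (∀ t, deriv (deriv ρ) t =
          ShallowWater.force μ a A (ρ t) - ShallowWater.damping μ g A (ρ t) * deriv ρ t) ∧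
        Tendsto ρ atBot (𝓝 (ShallowWater.rhoPlus A)) ∧
        Tendsto ρ atTop (𝓝 (ShallowWater.rhoMinus A)) ∧
        ∃ (α : ℝ) (C : ℕ → ℝ), 0 < α ∧ (∀ m, 0 < C m) ∧
          (∀ s ≤ 0, ∀ t ≥ 0,
            Real.exp (α * |s|) * |ρ s - ShallowWater.rhoPlus A| +
              Real.exp (α * |t|) * |ρ t - ShallowWater.rhoMinus A| ≤ C 0) ∧
          (∀ m ≥ 1, ∀ t, Real.exp (α * |t|) * |iteratedDeriv m ρ t| ≤ C m)) := by
  have hanti := ShallowWater.antitone_damping hμ hg hA0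
  refine ⟨fun hpos => ?_, fun hneg => ?_⟩
  · exact (ShallowWater.isDampedWell_force hμ ha hA0 hA1 (ShallowWater.contDiff_damping μ g A)
      fun x hx => hpos.trans_le (hanti hx.2)).exists_heteroclinic
  · -- Reversing time turns the damping `G < 0` into `-G > 0` and exchanges the two limits.
    obtain ⟨σ, hσs, hσI, hσ, hbot, htop, α, C, hα, hC, hC0, hCm⟩ :=
      (ShallowWater.isDampedWell_force hμ ha hA0 hA1
        (G := fun x => -ShallowWater.damping μ g A x)
        (ShallowWater.contDiff_damping μ g A).neg
        fun x hx => neg_pos.2 ((hanti hx.1).trans_lt hneg)).exists_heteroclinic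
    have hd1 : deriv (fun t => σ (-t)) = fun t => -deriv σ (-t) :=
      funext fun t => deriv_comp_neg σ t
    refine ⟨fun t => σ (-t), hσs.comp contDiff_neg, fun t => hσI (-t), fun t => ?_,
      htop.comp tendsto_neg_atBot_atTop, hbot.comp tendsto_neg_atTop_atBot, α, C, hα, hC,
      fun s hs t ht => ?_, fun m hm t => ?_⟩
    · rw [hd1, deriv.fun_neg, deriv_comp_neg (deriv σ) t, neg_neg, hσ]
      ring
    · have := hC0 (-t) (by linarith) (-s) (by linarith)
      rw [abs_neg, abs_neg] at this
      linarith
    · have := hCm m hm (-t)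
      rw [iteratedDeriv_comp_neg, smul_eq_mul, abs_mul, abs_pow, abs_neg, abs_one, one_pow, one_mul]
      rwa [abs_neg] at this
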